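/- Let $M$ be a smooth manifold, let $L\subset M$ be an embedded smooth submanifold with normal bundle $NL = TM|_L/TL$ and projection $\mathrm{pr}\colon TM|_L\to NL$, and let $\Psi\in\Omega^{2k+1}(M,TM)$, $k\ge 0$, be a smooth tangent-bundle-valued form with vanishing Frölicher–Nijenhuis square, $[\Psi,\Psi]^{FN}=0$. Assume that $L$ is a $\Psi$-submanifold, i.e. $\dim L\ge 2k+1$ and $\mathrm{pr}(\Psi(v_1,\dots,v_{2k+1}))=0$ for all $v_1,\dots,v_{2k+1}\in T_xL$, $x\in L$. Fix a tubular neighbourhood $\tau\colon NL\to M$, i.e. an injective local diffeomorphism which is the inclusion of $L$ on the zero section, and put $\Delta=\tau^*\Psi\in\Omega^{2k+1}(NL,T(NL))$. Let $\iota_L\colon \Omega^*(L,NL)\to\Omega^*(NL,T(NL))$ be the inclusion given by pulling back forms along the bundle projection and lifting normal vectors vertically, and let $P_L\colon\Omega^*(NL,T(NL))\to\Omega^*(L,NL)$ be the projection given by restriction to $L$ and the canonical projection $T(NL)|_L\to NL$. The $L_\infty$-algebra $\Omega^*(L,NL)[-1]$ associated with $L$ has the brackets $$\mathfrak l_n(a_1,\dots,a_n)=(-1)^{\star}\,P_L\big[\dots[[\Delta,\iota_L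 a_1]^{FN},\iota_L a_2]^{FN},\dots,\iota_L a_n\big]^{FN},\qquad n\ge1,$$ $$\star=(n-1)|a_1|+(n-2)|a_2|+\dots+|a_{n-1}|+\tfrac{n(n+1)}2,$$ where $|a|$, the degree in $\Omega^*(L,NL)[-1]$, is the form degree of $a$ plus one. A formal deformation of $L$ is a formal series $s(\varepsilon)=\sum_{i\ge0}\varepsilon^i s_i$ with $s_i\in\Gamma(NL)$ and $s_0=0$. It is a formal $\Psi$-deformation if $$F_\Psi(s(\varepsilon)):=P_L\big(\exp(\mathcal L_{\iota_L(s(\varepsilon))})\,\Delta\big)=\sum_{n\ge0}\frac1{n!}P_L\big(\mathcal L_{\iota_L(s(\varepsilon))}^n\Delta\big)=0\in\Omega^*(L,NL)[[\varepsilon]].$$ The formal Maurer–Cartan equation, with the brackets extended multilinearly to formal series, is $$MC(s(\varepsilon)):=\sum_{k\ge1}\frac1{k!}\,\mathfrak l_k(s(\varepsilon),\dots,s(\varepsilon))=0\in\Omega^*(L,NL)[[\varepsilon]].$$ Then, for every formal deformation $s(\varepsilon)$ of $L$: 1. $F_\Psi(s(\varepsilon))=0$ if and only if $MC(s(\varepsilon))=0$;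 that is, $s(\varepsilon)$ is a formal $\Psi$-deformation if and only if it solves the formal Maurer–Cartan equation. 2. $P_L\big(\exp(\mathcal L_{\iota_L(-s(\varepsilon))})\,\Delta\big)=0$ if and only if $MC(-s(\varepsilon))=0$. So if formal $\Psi$-deformations are defined with the opposite sign, by $P_L(\exp(\mathcal L_{\iota_L(-s(\varepsilon))})\Delta)=0$, then $s(\varepsilon)$ is a formal $\Psi$-deformation if and only if $-s(\varepsilon)$ solves the formal Maurer–Cartan equation. -/

import Mathlib

open scoped Manifold ContDiff
open Bundle

noncomputable section

namespace PsiDeformation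

/-! ### Embedded submanifolds and their normal bundles -/

/-- A submanifold of `M`, given as a smooth embedding `j : L → M` of a manifold `L`. -/
structure Submanifold (E E' : Type*) [NormedAddCommGroup E] [NormedSpace ℝ E]
    [NormedAddCommGroup E'] [NormedSpace ℝ E'] (L M : Type*)
    [TopologicalSpace L] [ChartedSpace (E) L]
    [TopologicalSpace M] [ChartedSpace (E') M] where
  /-- The inclusion `j : L → M`. -/
  incl : L → M
  isSmoothEmbedding : Manifold.IsSmoothEmbedding 𝓘(ℝ, E) 𝓘(ℝ, E') ∞ incl

namespace Submanifold

variable {E E' : Type*} [NormedAddCommGroup E] [NormedSpace ℝ E]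
  [NormedAddCommGroup E'] [NormedSpace ℝ E'] {L M : Type*}
  [TopologicalSpace L] [ChartedSpace (E) L]
  [TopologicalSpace M] [ChartedSpace (E') M]
  (S : Submanifold E E' L M)

/-- The differential `T_x j : T_x L → T_{j x} M`. -/
def dIncl (x : L) : TangentSpace 𝓘(ℝ, E) x →L[ℝ] TangentSpace 𝓘(ℝ, E') (S.incl x) :=
  mfderiv 𝓘(ℝ, E) 𝓘(ℝ, E') S.incl x

/-- The fibre `N_x L = T_{j x} M / T_x j (T_x L)` of the normal bundle, with the quotient topology. -/
def Normal (x : L) : Type _ :=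
  TangentSpace 𝓘(ℝ, E') (S.incl x) ⧸ (S.dIncl x).range

instance (x : L) : AddCommGroup (S.Normal x) :=
  inferInstanceAs (AddCommGroup (TangentSpace 𝓘(ℝ, E') (S.incl x) ⧸ (S.dIncl x).range))

instance (x : L) : Module ℝ (S.Normal x) :=
  inferInstanceAs (Module ℝ (TangentSpace 𝓘(ℝ, E') (S.incl x) ⧸ (S.dIncl x).range))

instance (x : L) : TopologicalSpace (S.Normal x) :=
  inferInstanceAs (TopologicalSpace (TangentSpace 𝓘(ℝ, E') (S.incl x) ⧸ (S.dIncl x).range))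

instance (x : L) : IsTopologicalAddGroup (S.Normal x) :=
  inferInstanceAs (IsTopologicalAddGroup (TangentSpace 𝓘(ℝ, E') (S.incl x) ⧸ (S.dIncl x).range))

instance (x : L) : ContinuousSMul ℝ (S.Normal x) :=
  inferInstanceAs (ContinuousSMul ℝ (TangentSpace 𝓘(ℝ, E') (S.incl x) ⧸ (S.dIncl x).range))

/-- The canonical projection `pr : T_{j x} M → N_x L`. -/
def pr (x : L) : TangentSpace 𝓘(ℝ, E') (S.incl x) →L[ℝ] S.Normal x :=
  (S.dIncl x).range.mkQL

theorem pr_surjective (x : L) : Function.Surjective (S.pr x) :=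
  Submodule.mkQ_surjective _

theorem pr_eq_zero {x : L} {t : TangentSpace 𝓘(ℝ, E') (S.incl x)} :
    S.pr x t = 0 ↔ ∃ v, S.dIncl x v = t :=
  (Submodule.Quotient.mk_eq_zero _).trans Iff.rfl

theorem dIncl_injective [IsManifold 𝓘(ℝ, E) ∞ L] [IsManifold 𝓘(ℝ, E') ∞ M] (x : L) :
    Function.Injective (S.dIncl x) := by
  have h : Manifold.IsImmersionAt 𝓘(ℝ, E) 𝓘(ℝ, E') ∞ S.incl x :=
    S.isSmoothEmbedding.isImmersion.isImmersionAt x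
  have hφ : h.domChart.MDifferentiable 𝓘(ℝ, E) 𝓘(ℝ, E) :=
    ⟨(contMDiffOn_of_mem_maximalAtlas h.domChart_mem_maximalAtlas).mdifferentiableOn (by simp),
      (contMDiffOn_symm_of_mem_maximalAtlas h.domChart_mem_maximalAtlas).mdifferentiableOn (by simp)⟩
  have hψ : MDifferentiableAt 𝓘(ℝ, E') 𝓘(ℝ, E') h.codChart (S.incl x) :=
    (contMDiffAt_of_mem_maximalAtlas h.codChart_mem_maximalAtlas
      h.mem_codChart_source).mdifferentiableAt (by simp)
  have hj : MDifferentiableAt 𝓘(ℝ, E) 𝓘(ℝ, E') S.incl x := h.contMDiffAt.mdifferentiableAt (by simp)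
  have hφx : MDifferentiableAt 𝓘(ℝ, E) 𝓘(ℝ, E) h.domChart x :=
    hφ.mdifferentiableAt h.mem_domChart_source
  let A : E →L[ℝ] E' :=
    h.equiv.toContinuousLinearMap.comp (ContinuousLinearMap.inl ℝ _ _)
  have hA : Function.Injective A := by
    intro a b hab
    have := h.equiv.injective hab
    simpa using this
  have heq : h.codChart ∘ S.incl =ᶠ[nhds x] A ∘ h.domChart := by
    filter_upwards [h.domChart.open_source.mem_nhds h.mem_domChart_source] with y hy
    have hy2 : h.domChart y ∈ (h.domChart.extend 𝓘(ℝ, E)).target := by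
      simpa using h.domChart.map_source hy
    have := h.writtenInCharts hy2
    simpa [h.domChart.left_inv hy, A] using this
  have hAd : MDifferentiableAt 𝓘(ℝ, E) 𝓘(ℝ, E') A (h.domChart x) :=
    A.differentiableAt.mdifferentiableAt
  intro v w hvw
  have h1 := heq.mfderiv_eq (I := 𝓘(ℝ, E)) (I' := 𝓘(ℝ, E'))
  rw [mfderiv_comp x hψ hj, mfderiv_comp x hAd hφx] at h1
  have hv := congrArg (fun T => T v) h1
  have hw := congrArg (fun T => T w) h1
  have e : mfderiv 𝓘(ℝ, E) 𝓘(ℝ, E') S.incl x v = mfderiv 𝓘(ℝ, E) 𝓘(ℝ, E') S.incl x w := hvw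
  have h2 : mfderiv 𝓘(ℝ, E) 𝓘(ℝ, E') A (h.domChart x) (mfderiv 𝓘(ℝ, E) 𝓘(ℝ, E) h.domChart x v)
      = mfderiv 𝓘(ℝ, E) 𝓘(ℝ, E') A (h.domChart x) (mfderiv 𝓘(ℝ, E) 𝓘(ℝ, E) h.domChart x w) := by
    refine hv.symm.trans (Eq.trans ?_ hw)
    exact congrArg (mfderiv 𝓘(ℝ, E') 𝓘(ℝ, E') h.codChart (S.incl x)) e
  rw [mfderiv_eq_fderiv, A.fderiv] at h2
  exact hφ.mfderiv_injective h.mem_domChart_source (hA h2)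

variable [FiniteDimensional ℝ E] [FiniteDimensional ℝ E'] [IsManifold 𝓘(ℝ, E) ∞ L] [IsManifold 𝓘(ℝ, E') ∞ M]

/-- The preferred local trivialization of `TM` around `y`. -/
abbrev tangentTriv (E : Type*) [NormedAddCommGroup E] [NormedSpace ℝ E] {N : Type*}
    [TopologicalSpace N] [ChartedSpace E N] [IsManifold 𝓘(ℝ, E) ∞ N] (y : N) :
    Trivialization E (TotalSpace.proj : TotalSpace E (TangentSpace 𝓘(ℝ, E) : N → Type _) → N) :=
  trivializationAt E (TangentSpace 𝓘(ℝ, E)) y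

/-- The model fibre of the normal bundle. -/
abbrev ModelFibre (_S : Submanifold E E' L M) : Type :=
  EuclideanSpace ℝ (Fin (Module.finrank ℝ E' - Module.finrank ℝ E))

/-- The linear map `f ↦ pr (c f)`, where `c` maps the model fibre to the model space of `M`, identified
with `T_{j x} M` in the local trivialization of `TM` around `y`. -/
def frame (y : M) (c : S.ModelFibre →L[ℝ] E') (x : L) :
    S.ModelFibre →L[ℝ] S.Normal x :=
  (S.pr x).comp (((tangentTriv E' y).symmL ℝ (S.incl x)).comp c)

/-- The points at which `frame` is an isomorphism onto the fibre of the normal bundle. -/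
def frameSet (y : M) (c : S.ModelFibre →L[ℝ] E') : Set L :=
  {x | S.incl x ∈ (tangentTriv E' y).baseSet ∧ Function.Bijective (S.frame y c x)}

/-- The differential of the inclusion in local trivializations. -/
def localDIncl (y : M) (x₁ x : L) : E →L[ℝ] E' :=
  ((tangentTriv E' y).continuousLinearMapAt ℝ (S.incl x)).comp
    ((S.dIncl x).comp ((tangentTriv E x₁).symmL ℝ x))

/-- The sum of the differential of the inclusion and of `c`, in local trivializations. -/
def localSum (y : M) (c : S.ModelFibre →L[ℝ] E') (x₁ x : L) :
    E × S.ModelFibre →L[ℝ] E' :=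
  (S.localDIncl y x₁ x).comp (ContinuousLinearMap.fst ℝ _ _) +
    c.comp (ContinuousLinearMap.snd ℝ _ _)

theorem contMDiffAt_localDIncl (y : M) {x₁ : L} (hx₁ : S.incl x₁ ∈ (tangentTriv E' y).baseSet) :
    ContMDiffAt 𝓘(ℝ, E) 𝓘(ℝ, E →L[ℝ] E') ∞
      (S.localDIncl y x₁) x₁ := by
  have hj : ContMDiffAt 𝓘(ℝ, E) 𝓘(ℝ, E') ∞ S.incl x₁ := S.isSmoothEmbedding.contMDiff x₁
  have h1 := ContMDiffAt.mfderiv_const (m := ∞) hj (by simp)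
  have h2 : ContMDiffAt 𝓘(ℝ, E') 𝓘(ℝ, E' →L[ℝ] E') ∞
      (fun b => (Trivialization.coordChangeL ℝ (tangentTriv E' (S.incl x₁)) (tangentTriv E' y) b :
        E' →L[ℝ] E')) (S.incl x₁) :=
    (contMDiffOn_coordChangeL (tangentTriv E' (S.incl x₁)) (tangentTriv E' y)).contMDiffAt
      (((tangentTriv E' (S.incl x₁)).open_baseSet.inter (tangentTriv E' y).open_baseSet).mem_nhds
        ⟨mem_baseSet_trivializationAt _ _ _, hx₁⟩)
  refine ((h2.comp x₁ hj).clm_comp h1).congr_of_eventuallyEq ?_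
  filter_upwards [hj.continuousAt.eventually_mem ((tangentTriv E' y).open_baseSet.mem_nhds hx₁),
    hj.continuousAt.eventually_mem ((tangentTriv E' (S.incl x₁)).open_baseSet.mem_nhds
      (mem_baseSet_trivializationAt _ _ _))] with x hx hx'
  refine ContinuousLinearMap.ext fun v => ?_
  have h3 := Trivialization.coordChangeL_apply (R := ℝ) (tangentTriv E' (S.incl x₁))
    (tangentTriv E' y) ⟨hx', hx⟩ ((tangentTriv E' (S.incl x₁)).continuousLinearMapAt ℝ (S.incl x)
        (S.dIncl x ((tangentTriv E x₁).symmL ℝ x v)))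
  have h4 := Trivialization.symmL_continuousLinearMapAt (R := ℝ) (tangentTriv E' (S.incl x₁)) hx'
    (S.dIncl x ((tangentTriv E x₁).symmL ℝ x v))
  rw [← Trivialization.symmL_apply (R := ℝ) _ hx', h4] at h3
  refine Eq.trans ?_ h3.symm
  exact Trivialization.continuousLinearMapAt_apply_of_mem (R := ℝ) _ hx _

theorem contMDiffAt_localSum (y : M) (c : S.ModelFibre →L[ℝ] E') {x₁ : L}
    (hx₁ : S.incl x₁ ∈ (tangentTriv E' y).baseSet) :
    ContMDiffAt 𝓘(ℝ, E) 𝓘(ℝ, E × S.ModelFibre →L[ℝ]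
      E') ∞ (S.localSum y c x₁) x₁ :=
  ((S.contMDiffAt_localDIncl y hx₁).clm_comp contMDiffAt_const).add contMDiffAt_const

theorem localSum_apply (y : M) (c : S.ModelFibre →L[ℝ] E') (x₁ x : L)
    (a : E) (f : S.ModelFibre) :
    S.localSum y c x₁ x (a, f) = (tangentTriv E' y).continuousLinearMapAt ℝ (S.incl x)
      (S.dIncl x ((tangentTriv E x₁).symmL ℝ x a)) + c f := rfl

theorem symmL_localSum (y : M) (c : S.ModelFibre →L[ℝ] E') (x₁ : L) {x : L}
    (hx : S.incl x ∈ (tangentTriv E' y).baseSet) (a : E)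
    (f : S.ModelFibre) :
    (tangentTriv E' y).symmL ℝ (S.incl x) (S.localSum y c x₁ x (a, f)) =
      S.dIncl x ((tangentTriv E x₁).symmL ℝ x a) +
        (tangentTriv E' y).symmL ℝ (S.incl x) (c f) := by
  rw [localSum_apply, map_add, Trivialization.symmL_continuousLinearMapAt _ hx]

theorem frame_eq (y : M) (c : S.ModelFibre →L[ℝ] E') (x₁ : L) {x : L}
    (hx : S.incl x ∈ (tangentTriv E' y).baseSet) (p : E × S.ModelFibre) :
    S.frame y c x p.2 =
      S.pr x ((tangentTriv E' y).symmL ℝ (S.incl x) (S.localSum y c x₁ x p)) := by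
  obtain ⟨a, f⟩ := p
  rw [symmL_localSum _ _ _ _ hx, map_add, S.pr_eq_zero.2 ⟨_, rfl⟩, zero_add]
  rfl

theorem eq_localSum_of_frame (y : M) (c : S.ModelFibre →L[ℝ] E') (x₁ : L)
    {x : L} (hx : S.incl x ∈ (tangentTriv E' y).baseSet) (hx₁ : x ∈ (tangentTriv E x₁).baseSet)
    (f : S.ModelFibre) (t : E')
    (h : S.frame y c x f = S.pr x ((tangentTriv E' y).symmL ℝ (S.incl x) t)) :
    ∃ a, S.localSum y c x₁ x (a, f) = t := by
  rw [eq_comm, S.frame_eq y c x₁ hx (0, f), ← sub_eq_zero, ← map_sub, ← map_sub,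
    S.pr_eq_zero] at h
  obtain ⟨v, hv⟩ := h
  have h1 := congrArg ((tangentTriv E' y).continuousLinearMapAt ℝ (S.incl x)) hv
  rw [Trivialization.continuousLinearMapAt_symmL _ hx] at h1
  refine ⟨(tangentTriv E x₁).continuousLinearMapAt ℝ x v, ?_⟩
  rw [localSum_apply, map_zero, map_zero, map_zero, zero_add] at h1
  rw [localSum_apply, Trivialization.symmL_continuousLinearMapAt _ hx₁, h1, sub_add_cancel]

theorem localSum_bijective (y : M) (c : S.ModelFibre →L[ℝ] E') {x₁ : L}
    (hx : x₁ ∈ S.frameSet y c) : Function.Bijective (S.localSum y c x₁ x₁) := by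
  obtain ⟨hx, hinj, hsur⟩ := hx
  have hxR : x₁ ∈ (tangentTriv E x₁).baseSet := mem_baseSet_trivializationAt _ _ _
  constructor
  · rw [injective_iff_map_eq_zero]
    rintro ⟨a, f⟩ h0
    have hf : f = 0 := by
      apply hinj
      rw [S.frame_eq y c x₁ hx (a, f), h0, map_zero, map_zero, map_zero]
    subst hf
    have h1 := S.symmL_localSum y c x₁ hx a 0
    rw [h0, map_zero, map_zero, map_zero, add_zero] at h1
    have ha2 : (tangentTriv E x₁).symmL ℝ x₁ a = 0 :=
      S.dIncl_injective x₁ (h1.symm.trans (map_zero _).symm)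
    have := Trivialization.continuousLinearMapAt_symmL (R := ℝ) (tangentTriv E x₁) hxR a
    rw [ha2, map_zero] at this
    rw [← this]; rfl
  · intro t
    obtain ⟨f, hf⟩ := hsur (S.pr x₁ ((tangentTriv E' y).symmL ℝ (S.incl x₁) t))
    obtain ⟨a, ha⟩ := S.eq_localSum_of_frame y c x₁ hx hxR f t hf
    exact ⟨_, ha⟩

theorem exists_local_inverse (y : M) (c : S.ModelFibre →L[ℝ] E') {x₁ : L}
    (hx₁ : x₁ ∈ S.frameSet y c) :
    ∃ Q : L → (E' →L[ℝ] S.ModelFibre),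
      ContMDiffAt 𝓘(ℝ, E) 𝓘(ℝ, E' →L[ℝ] S.ModelFibre) ∞ Q x₁ ∧
      ∀ᶠ x in nhds x₁, x ∈ S.frameSet y c ∧ ∀ t : E',
        S.frame y c x (Q x t) = S.pr x ((tangentTriv E' y).symmL ℝ (S.incl x) t) := by
  have hj : ContMDiffAt 𝓘(ℝ, E) 𝓘(ℝ, E') ∞ S.incl x₁ := S.isSmoothEmbedding.contMDiff x₁
  have hD := S.contMDiffAt_localSum y c hx₁.1
  have hbij := S.localSum_bijective y c hx₁
  let e : (E × S.ModelFibre) ≃L[ℝ] E' :=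
    (LinearEquiv.ofBijective (S.localSum y c x₁ x₁).toLinearMap hbij).toContinuousLinearEquiv
  have he : (e : _ →L[ℝ] E') = S.localSum y c x₁ x₁ :=
    ContinuousLinearMap.ext fun v => rfl
  have hinv : ContMDiffAt 𝓘(ℝ, E) 𝓘(ℝ, E' →L[ℝ]
      E × S.ModelFibre) ∞
      (fun x => (S.localSum y c x₁ x).inverse) x₁ := by
    have := contDiffAt_map_inverse (n := ∞) e
    rw [he] at this
    exact this.contMDiffAt.comp x₁ hD
  refine ⟨fun x => (ContinuousLinearMap.snd ℝ _ _).comp (S.localSum y c x₁ x).inverse,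
    contMDiffAt_const.clm_comp hinv, ?_⟩
  have hnear : ∀ᶠ x in nhds x₁, S.localSum y c x₁ x ∈ Set.range
      ((↑) : ((E × S.ModelFibre) ≃L[ℝ] E') →
        ((E × S.ModelFibre) →L[ℝ] E')) :=
    hD.continuousAt.eventually_mem (he ▸ ContinuousLinearEquiv.nhds e)
  filter_upwards [hj.continuousAt.eventually_mem ((tangentTriv E' y).open_baseSet.mem_nhds hx₁.1),
    (tangentTriv E x₁).open_baseSet.mem_nhds (mem_baseSet_trivializationAt _ _ _),
    hnear] with x hx hxR hxe
  obtain ⟨e', he'⟩ := hxe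
  have key : ∀ t : E',
      S.frame y c x ((S.localSum y c x₁ x).inverse t).2 =
        S.pr x ((tangentTriv E' y).symmL ℝ (S.incl x) t) := by
    intro t
    rw [S.frame_eq y c x₁ hx, ← he', ContinuousLinearMap.inverse_equiv]
    simp only [ContinuousLinearEquiv.coe_coe, ContinuousLinearEquiv.apply_symm_apply]
  refine ⟨⟨hx, ?_, ?_⟩, key⟩
  · rw [injective_iff_map_eq_zero]
    intro f hf
    obtain ⟨a, ha⟩ := S.eq_localSum_of_frame y c x₁ hx hxR f 0
      (by rw [hf, map_zero, map_zero])
    rw [← he'] at ha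
    exact congrArg Prod.snd (e'.injective (ha.trans (map_zero e').symm))
  · intro n
    obtain ⟨t, rfl⟩ := S.pr_surjective x n
    refine ⟨_, (key ((tangentTriv E' y).continuousLinearMapAt ℝ (S.incl x) t)).trans ?_⟩
    rw [Trivialization.symmL_continuousLinearMapAt _ hx]


theorem exists_mem_frameSet (x : L) :
    ∃ c : S.ModelFibre →L[ℝ] E', x ∈ S.frameSet (S.incl x) c := by
  have hx : S.incl x ∈ (tangentTriv E' (S.incl x)).baseSet := mem_baseSet_trivializationAt _ _ _
  let A : E →ₗ[ℝ] E' := (S.dIncl x).toLinearMap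
  have hA : Function.Injective A := S.dIncl_injective x
  have hrank : Module.finrank ℝ S.ModelFibre =
      Module.finrank ℝ (E' ⧸ LinearMap.range A) := by
    rw [Submodule.finrank_quotient, LinearMap.finrank_range_of_inj hA]
    simp
  let φ := LinearEquiv.ofFinrankEq _ _ hrank
  obtain ⟨σ, hσ⟩ := (LinearMap.range A).mkQ.exists_rightInverse_of_surjective
    (Submodule.range_mkQ _)
  let τ : S.ModelFibre →L[ℝ] E' :=
    LinearMap.toContinuousLinearMap (σ ∘ₗ φ.toLinearMap)
  let σ' : S.ModelFibre →L[ℝ] TangentSpace 𝓘(ℝ, E') (S.incl x) := τ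
  have hσ' : ∀ f, S.pr x (σ' f) = φ f := fun f => LinearMap.congr_fun hσ (φ f)
  have hf : ∀ f, S.frame (S.incl x)
      (((tangentTriv E' (S.incl x)).continuousLinearMapAt ℝ (S.incl x)).comp σ') x f = φ f := by
    intro f
    refine Eq.trans (congrArg (S.pr x) ?_) (hσ' f)
    exact Trivialization.symmL_continuousLinearMapAt _ hx (σ' f)
  refine ⟨((tangentTriv E' (S.incl x)).continuousLinearMapAt ℝ (S.incl x)).comp σ', hx, ?_⟩
  rw [funext hf]
  exact φ.bijective

open Classical in
/-- The inverse of the local frame. -/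
def frameInv (y : M) (c : S.ModelFibre →L[ℝ] E') (x : L) :
    S.Normal x →ₗ[ℝ] S.ModelFibre :=
  if h : Function.Bijective (S.frame y c x) then
    (LinearEquiv.ofBijective (S.frame y c x).toLinearMap h).symm.toLinearMap
  else 0

theorem frameInv_frame {y : M} {c : S.ModelFibre →L[ℝ] E'} {x : L}
    (hx : x ∈ S.frameSet y c) (f : S.ModelFibre) : S.frameInv y c x (S.frame y c x f) = f := by
  rw [frameInv, dif_pos hx.2]
  exact (LinearEquiv.ofBijective (S.frame y c x).toLinearMap hx.2).symm_apply_apply f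

theorem frame_frameInv {y : M} {c : S.ModelFibre →L[ℝ] E'} {x : L}
    (hx : x ∈ S.frameSet y c) (n : S.Normal x) : S.frame y c x (S.frameInv y c x n) = n := by
  rw [frameInv, dif_pos hx.2]
  exact (LinearEquiv.ofBijective (S.frame y c x).toLinearMap hx.2).apply_symm_apply n

theorem continuous_frameInv (y : M) (c : S.ModelFibre →L[ℝ] E') (x : L) :
    Continuous (S.frameInv y c x) := by
  have hq : Topology.IsQuotientMap (S.pr x) := (Submodule.isOpenQuotientMap_mkQ _).isQuotientMap
  rw [hq.continuous_iff]
  let g : E' →ₗ[ℝ] S.ModelFibre :=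
    (S.frameInv y c x) ∘ₗ (S.pr x).toLinearMap
  exact g.continuous_of_finiteDimensional

theorem isOpen_frameSet (y : M) (c : S.ModelFibre →L[ℝ] E') :
    IsOpen (S.frameSet y c) := by
  rw [isOpen_iff_mem_nhds]
  intro x hx
  obtain ⟨Q, -, hQ⟩ := S.exists_local_inverse y c hx
  exact hQ.mono fun z hz => hz.1

/-- The local trivialization of the normal bundle given by the frame `frame y c`. -/
def pretriv (y : M) (c : S.ModelFibre →L[ℝ] E') :
    Pretrivialization S.ModelFibre (TotalSpace.proj : TotalSpace S.ModelFibre S.Normal → L) where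
  toFun p := (p.1, S.frameInv y c p.1 p.2)
  invFun q := ⟨q.1, S.frame y c q.1 q.2⟩
  source := TotalSpace.proj ⁻¹' S.frameSet y c
  target := S.frameSet y c ×ˢ Set.univ
  map_source' p hp := ⟨hp, Set.mem_univ _⟩
  map_target' q hq := hq.1
  left_inv' p hp := by
    obtain ⟨x, n⟩ := p
    simp only [S.frame_frameInv hp]
  right_inv' q hq := by
    obtain ⟨x, f⟩ := q
    simp only [S.frameInv_frame hq.1]
  open_target := (S.isOpen_frameSet y c).prod isOpen_univ
  baseSet := S.frameSet y c
  open_baseSet := S.isOpen_frameSet y c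
  source_eq := rfl
  target_eq := rfl
  proj_toFun _ _ := rfl

theorem pretriv_symm (y : M) (c : S.ModelFibre →L[ℝ] E') {x : L}
    (hx : x ∈ S.frameSet y c) (f : S.ModelFibre) :
    (S.pretriv y c).symm x f = S.frame y c x f := by
  rw [Pretrivialization.symm_apply _ hx]
  rfl

/-- The transition maps of the normal bundle are smooth. -/
theorem exists_contMDiff_coordChange (y : M) (c : S.ModelFibre →L[ℝ] E')
    (y' : M) (c' : S.ModelFibre →L[ℝ] E') :
    ∃ f : L → S.ModelFibre →L[ℝ] S.ModelFibre,
      ContMDiffOn 𝓘(ℝ, E) 𝓘(ℝ, S.ModelFibre →L[ℝ] S.ModelFibre) ∞ f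
        (S.frameSet y c ∩ S.frameSet y' c') ∧
      ∀ b ∈ S.frameSet y c ∩ S.frameSet y' c', ∀ v : S.ModelFibre,
        f b v = (S.pretriv y' c' ⟨b, (S.pretriv y c).symm b v⟩).2 := by
  refine ⟨fun x => LinearMap.toContinuousLinearMap
    ((S.frameInv y' c' x) ∘ₗ (S.frame y c x).toLinearMap), ?_, ?_⟩
  · intro x₁ hx₁
    apply ContMDiffAt.contMDiffWithinAt
    have hj : ContMDiffAt 𝓘(ℝ, E) 𝓘(ℝ, E') ∞ S.incl x₁ := S.isSmoothEmbedding.contMDiff x₁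
    obtain ⟨Q, hQs, hQ⟩ := S.exists_local_inverse y' c' hx₁.2
    have h2 : ContMDiffAt 𝓘(ℝ, E') 𝓘(ℝ, E' →L[ℝ] E') ∞
        (fun b => (Trivialization.coordChangeL ℝ (tangentTriv E' y) (tangentTriv E' y') b :
          E' →L[ℝ] E')) (S.incl x₁) :=
      (contMDiffOn_coordChangeL (tangentTriv E' y) (tangentTriv E' y')).contMDiffAt
        (((tangentTriv E' y).open_baseSet.inter (tangentTriv E' y').open_baseSet).mem_nhds
          ⟨hx₁.1.1, hx₁.2.1⟩)
    refine (hQs.clm_comp ((h2.comp x₁ hj).clm_comp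
      (contMDiffAt_const (c := c)))).congr_of_eventuallyEq ?_
    filter_upwards [hQ, (S.isOpen_frameSet y c).mem_nhds hx₁.1] with x hx hx'
    refine ContinuousLinearMap.ext fun v => ?_
    have h3 := Trivialization.coordChangeL_apply (R := ℝ) (tangentTriv E' y) (tangentTriv E' y')
      ⟨hx'.1, hx.1.1⟩ (c v)
    rw [← Trivialization.symmL_apply (R := ℝ) _ hx'.1,
      ← Trivialization.continuousLinearMapAt_apply_of_mem (R := ℝ) _ hx.1.1] at h3
    have h4 := hx.2 ((Trivialization.coordChangeL ℝ (tangentTriv E' y) (tangentTriv E' y')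
      (S.incl x) : E' →L[ℝ] E') (c v))
    have h5 := congrArg (S.frameInv y' c' x) h4
    rw [S.frameInv_frame hx.1] at h5
    refine Eq.trans ?_ h5.symm
    refine congrArg (S.frameInv y' c' x) ?_
    refine congrArg (S.pr x) ?_
    refine Eq.symm ((congrArg ((tangentTriv E' y').symmL ℝ (S.incl x)) h3).trans ?_)
    exact Trivialization.symmL_continuousLinearMapAt _ hx.1.1 _
  · intro b hb v
    rw [S.pretriv_symm y c hb.1]
    rfl

/-- The vector bundle structure on the normal bundle. -/
def normalPrebundle : VectorPrebundle ℝ S.ModelFibre S.Normal where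
  pretrivializationAtlas := {e | ∃ y c, e = S.pretriv y c}
  pretrivialization_linear' := by
    rintro _ ⟨y, c, rfl⟩
    exact ⟨fun b _ => (S.frameInv y c b).isLinear⟩
  pretrivializationAt x := S.pretriv (S.incl x) (S.exists_mem_frameSet x).choose
  mem_base_pretrivializationAt x := (S.exists_mem_frameSet x).choose_spec
  pretrivialization_mem_atlas x := ⟨_, _, rfl⟩
  exists_coordChange := by
    rintro _ ⟨y, c, rfl⟩ _ ⟨y', c', rfl⟩
    obtain ⟨f, hf, hf'⟩ := S.exists_contMDiff_coordChange y c y' c'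
    exact ⟨f, hf.continuousOn, hf'⟩
  totalSpaceMk_isInducing x := by
    have hx := (S.exists_mem_frameSet x).choose_spec
    set c := (S.exists_mem_frameSet x).choose
    have h : Topology.IsInducing (S.frameInv (S.incl x) c x) :=
      Topology.IsInducing.of_comp (S.continuous_frameInv (S.incl x) c x)
        (S.frame (S.incl x) c x).continuous (by
          have : (S.frame (S.incl x) c x) ∘ (S.frameInv (S.incl x) c x) = id :=
            funext fun n => S.frame_frameInv hx n
          rw [this]
          exact Topology.IsInducing.id)
    exact (Topology.isInducing_const_prod.2 h)

/-! The normal bundle is a smooth vector bundle over `L`. -/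

instance : TopologicalSpace (TotalSpace S.ModelFibre S.Normal) :=
  S.normalPrebundle.totalSpaceTopology

instance : FiberBundle S.ModelFibre S.Normal :=
  S.normalPrebundle.toFiberBundle

instance : VectorBundle ℝ S.ModelFibre S.Normal :=
  S.normalPrebundle.toVectorBundle

instance : S.normalPrebundle.IsContMDiff 𝓘(ℝ, E) ∞ where
  exists_contMDiffCoordChange := by
    rintro _ ⟨y, c, rfl⟩ _ ⟨y', c', rfl⟩
    exact S.exists_contMDiff_coordChange y c y' c'

instance : ContMDiffVectorBundle ∞ S.ModelFibre S.Normal 𝓘(ℝ, E) :=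
  S.normalPrebundle.contMDiffVectorBundle 𝓘(ℝ, E)

end Submanifold

/-! ### Calculus of vector valued forms in a vector space -/

section Linear

variable {E G : Type*} [NormedAddCommGroup E] [NormedSpace ℝ E]
  [NormedAddCommGroup G] [NormedSpace ℝ G]

/-- Transport of an alternating form along an equality of degrees. -/
def castDegree {V W : Type*} [AddCommGroup V] [Module ℝ V] [TopologicalSpace V]
    [AddCommGroup W] [Module ℝ W] [TopologicalSpace W] {p q : ℕ} (h : p = q)
    (K : V [⋀^Fin p]→L[ℝ] W) : V [⋀^Fin q]→L[ℝ] W :=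
  h ▸ K

/-- `(v_1, …, v_{p+q}) ↦ B (A (v_1, …, v_p), v_{p+1}, …, v_{p+q})`. -/
def insertionAux {p q : ℕ} (A : E [⋀^Fin p]→L[ℝ] E) (B : E [⋀^Fin (q + 1)]→L[ℝ] G) :
    ContinuousMultilinearMap ℝ (fun _ : Fin (p + q) => E) G where
  toFun v := B (Fin.cons (A fun i => v (Fin.castAdd q i)) fun j => v (Fin.natAdd p j))
  map_update_add' := by
    intro inst v i x y
    induction i using Fin.addCases with
    | left i =>
      have h1 : ∀ z, (fun k : Fin p => Function.update v (Fin.castAdd q i) z (Fin.castAdd q k)) =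
          Function.update (fun k => v (Fin.castAdd q k)) i z := fun z =>
        Function.update_comp_eq_of_injective v (Fin.castAdd_injective p q) i z
      have h2 : ∀ z, (fun k : Fin q => Function.update v (Fin.castAdd q i) z (Fin.natAdd p k)) =
          fun k => v (Fin.natAdd p k) := fun z => funext fun k =>
        Function.update_of_ne (by simp [Fin.ext_iff]; omega) _ _
      simp only [h1, h2, ContinuousAlternatingMap.map_update_add]
      exact B.cons_add _ _ _
    | right i =>
      have h1 : ∀ z, (fun k : Fin p => Function.update v (Fin.natAdd p i) z (Fin.castAdd q k)) =
          fun k => v (Fin.castAdd q k) := fun z => funext fun k =>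
        Function.update_of_ne (by simp [Fin.ext_iff]; omega) _ _
      have h2 : ∀ z, (fun k : Fin q => Function.update v (Fin.natAdd p i) z (Fin.natAdd p k)) =
          Function.update (fun k => v (Fin.natAdd p k)) i z := fun z =>
        Function.update_comp_eq_of_injective v (Fin.natAdd_injective q p) i z
      simp only [h1, h2, Fin.cons_update, ContinuousAlternatingMap.map_update_add]
  map_update_smul' := by
    intro inst v i c x
    induction i using Fin.addCases with
    | left i =>
      have h1 : ∀ z, (fun k : Fin p => Function.update v (Fin.castAdd q i) z (Fin.castAdd q k)) =
          Function.update (fun k => v (Fin.castAdd q k)) i z := fun z =>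
        Function.update_comp_eq_of_injective v (Fin.castAdd_injective p q) i z
      have h2 : ∀ z, (fun k : Fin q => Function.update v (Fin.castAdd q i) z (Fin.natAdd p k)) =
          fun k => v (Fin.natAdd p k) := fun z => funext fun k =>
        Function.update_of_ne (by simp [Fin.ext_iff]; omega) _ _
      simp only [h1, h2, ContinuousAlternatingMap.map_update_smul]
      exact B.cons_smul _ _ _
    | right i =>
      have h1 : ∀ z, (fun k : Fin p => Function.update v (Fin.natAdd p i) z (Fin.castAdd q k)) =
          fun k => v (Fin.castAdd q k) := fun z => funext fun k =>
        Function.update_of_ne (by simp [Fin.ext_iff]; omega) _ _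
      have h2 : ∀ z, (fun k : Fin q => Function.update v (Fin.natAdd p i) z (Fin.natAdd p k)) =
          Function.update (fun k => v (Fin.natAdd p k)) i z := fun z =>
        Function.update_comp_eq_of_injective v (Fin.natAdd_injective q p) i z
      simp only [h1, h2, Fin.cons_update, ContinuousAlternatingMap.map_update_smul]
  cont := by
    refine B.cont.comp (continuous_pi fun k => ?_)
    refine Fin.cases ?_ (fun k => ?_) k
    · exact A.cont.comp (continuous_pi fun i => continuous_apply _)
    · exact continuous_apply _

/-- The insertion `ι_A B` of a vector valued `p`-form `A` into a `(q+1)`-form `B`: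
`(ι_A B)(v_1, …, v_{p+q}) =
  1/(p! q!) ∑_σ sign(σ) B (A (v_{σ 1}, …, v_{σ p}), v_{σ (p+1)}, …, v_{σ (p+q)})`,
so that `ι_{α ⊗ X} β = α ∧ ι_X β`. -/
def insertion {p q : ℕ} (A : E [⋀^Fin p]→L[ℝ] E) (B : E [⋀^Fin (q + 1)]→L[ℝ] G) :
    E [⋀^Fin (p + q)]→L[ℝ] G :=
  ((p.factorial * q.factorial : ℝ)⁻¹) • (insertionAux A B).alternatization

/-- The Lie derivative `𝓛_K β = [ι_K, d] β = ι_K (d β) - (-1)^(p-1) d (ι_K β)` of a form `β` along a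
vector valued `p`-form `K`; here `ι_K β = 0` when `β` has degree zero. -/
def nijenhuisLie {p : ℕ} (K : E → E [⋀^Fin p]→L[ℝ] E) :
    {q : ℕ} → (E → E [⋀^Fin q]→L[ℝ] G) → E → E [⋀^Fin (p + q)]→L[ℝ] G
  | 0, β, y => insertion (K y) (extDeriv β y)
  | _ + 1, β, y => insertion (K y) (extDeriv β y) +
      (-1 : ℝ) ^ p • extDeriv (fun z => insertion (K z) (β z)) y

/-- The Frölicher-Nijenhuis bracket on a vector space. The identity `𝓛_[K, K'] = [𝓛_K, 𝓛_K']`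
between derivations that commute with `d` can be tested on the coordinate functions, that is, on the
identity map `id : E → E`; as `𝓛_K id = ι_K (d id)` is `K` regarded as an `E`-valued form, it reads
`[K, K'] = 𝓛_K K' - (-1)^(p q) 𝓛_K' K`. -/
def fnLocal {p q : ℕ} (K : E → E [⋀^Fin p]→L[ℝ] E) (K' : E → E [⋀^Fin q]→L[ℝ] E) (y : E) :
    E [⋀^Fin (p + q)]→L[ℝ] E :=
  nijenhuisLie K K' y - (-1 : ℝ) ^ (p * q) • castDegree (Nat.add_comm q p) (nijenhuisLie K' K y)

/-- `(v_1, …, v_p) ↦ ∑ i, K (v_1, …, A v_i, …, v_p)`. -/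
def derivationAction {p : ℕ} (A : E →L[ℝ] E) (K : E [⋀^Fin p]→L[ℝ] E) : E [⋀^Fin p]→L[ℝ] E where
  toContinuousMultilinearMap := ∑ i, K.toContinuousMultilinearMap.compContinuousLinearMap
    (Function.update (fun _ => ContinuousLinearMap.id ℝ E) i A)
  map_eq_zero_of_eq' := by
    intro v i j hv hij
    have hterm : ∀ k, (fun k' => Function.update (fun _ => ContinuousLinearMap.id ℝ E) k A k'
        (v k')) = Function.update v k (A (v k)) := by
      intro k
      funext k'
      by_cases h : k' = k
      · subst h; simp
      · simp [h]
    change (∑ k, K.toContinuousMultilinearMap.compContinuousLinearMap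
      (Function.update (fun _ => ContinuousLinearMap.id ℝ E) k A)) v = 0
    simp only [sum_apply,
      ContinuousMultilinearMap.compContinuousLinearMap_apply, hterm]
    change ∑ k, K (Function.update v k (A (v k))) = 0
    rw [Finset.sum_eq_add i j hij]
    · have h1 : Function.update v i (A (v i)) =
          Function.update v j (A (v j)) ∘ Equiv.swap i j := by
        funext k
        by_cases hki : k = i
        · subst hki; simp [hv]
        · by_cases hkj : k = j
          · subst hkj; simp [hij, Ne.symm hij, hv]
          · simp [hki, hkj, Equiv.swap_apply_of_ne_of_ne]
      have h2 := K.toAlternatingMap.map_swap (Function.update v j (A (v j))) hij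
      rw [h1]
      change K.toAlternatingMap _ + K.toAlternatingMap _ = 0
      rw [h2, neg_add_cancel]
    · intro k _ hk
      exact K.map_eq_zero_of_eq _ (i := i) (j := j) (by simp [hk.1.symm, hk.2.symm, hv]) hij
    · simp
    · simp

/-- The Lie derivative of a vector valued form along a vector field, on a vector space: the
derivative at time zero of the pullback of `K` by the flow of `X`, that is
`(L_X K)(v_1, …, v_p) = (D_X K)(v_1, …, v_p) - D_{K(v_1, …, v_p)} X + ∑ i, K(v_1, …, D_{v_i} X, …, v_p)`. -/
def lieLocal {p : ℕ} (X : E → E) (K : E → E [⋀^Fin p]→L[ℝ] E) (y : E) : E [⋀^Fin p]→L[ℝ] E :=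
  fderiv ℝ K y (X y) - (fderiv ℝ X y).compContinuousAlternatingMap (K y) +
    derivationAction (fderiv ℝ X y) (K y)

end Linear

/-! ### Vector valued forms on a manifold -/

section Forms

variable {E H : Type*} [NormedAddCommGroup E] [NormedSpace ℝ E] [TopologicalSpace H]
  (I : ModelWithCorners ℝ E H) (N : Type*) [TopologicalSpace N] [ChartedSpace H N]

/-- `TN`-valued differential `p`-forms on `N` (no regularity imposed). -/
abbrev VForm (p : ℕ) : Type _ :=
  ∀ x : N, TangentSpace I x [⋀^Fin p]→L[ℝ] TangentSpace I x

/-- Elements of `Ω^*(N, TN)`, given by their components of degree `0, 1, 2, …`. Components of degree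
larger than the dimension vanish automatically. -/
abbrev GForm : Type _ := ∀ p : ℕ, VForm I N p

variable {I N}

/-- The differential at `x` of the preferred chart around `x₀`. -/
def chartDeriv (x₀ x : N) : TangentSpace I x →L[ℝ] E :=
  mfderiv I 𝓘(ℝ, E) (extChartAt I x₀) x

/-- The vector valued form `K` in the preferred chart around `x₀`. -/
def VForm.inChart {p : ℕ} (K : VForm I N p) (x₀ : N) (y : E) : E [⋀^Fin p]→L[ℝ] E :=
  let x := (extChartAt I x₀).symm y
  ((chartDeriv (I := I) x₀ x).compContinuousAlternatingMap (K x)).compContinuousLinearMap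
    (chartDeriv (I := I) x₀ x).inverse

/-- Transport of a form at the centre of the preferred chart around `x` to `T_x N`. -/
def ofChart {p : ℕ} (x : N) (K : E [⋀^Fin p]→L[ℝ] E) :
    TangentSpace I x [⋀^Fin p]→L[ℝ] TangentSpace I x :=
  ((chartDeriv (I := I) x x).inverse.compContinuousAlternatingMap K).compContinuousLinearMap
    (chartDeriv (I := I) x x)

/-- Smoothness of a vector valued form on a manifold without boundary. -/
def VForm.IsSmooth {p : ℕ} (K : VForm I N p) : Prop :=
  ∀ x₀ : N, ContDiffOn ℝ ∞ (K.inChart x₀) (extChartAt I x₀).target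

/-- The Frölicher-Nijenhuis bracket, computed at each point in the preferred chart around that point
(the bracket is invariant under diffeomorphisms). -/
def fnBracket {p q : ℕ} (K : VForm I N p) (K' : VForm I N q) : VForm I N (p + q) := fun x =>
  ofChart x (fnLocal (K.inChart x) (K'.inChart x) (extChartAt I x x))

/-- The Frölicher-Nijenhuis bracket on `Ω^*(N, TN)`. -/
def gBracket (K K' : GForm I N) : GForm I N := fun r x =>
  ∑ a ∈ (Finset.HasAntidiagonal.antidiagonal r).attach,
    castDegree (Finset.HasAntidiagonal.mem_antidiagonal.1 a.2) (fnBracket (K a.1.1) (K' a.1.2) x)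

/-- The Lie derivative of a vector valued form along a vector field, computed at each point in the
preferred chart around that point. -/
def lieDeriv {p : ℕ} (X : ∀ x : N, TangentSpace I x) (K : VForm I N p) : VForm I N p := fun x =>
  ofChart x (lieLocal
    (fun y => chartDeriv x ((extChartAt I x).symm y) (X ((extChartAt I x).symm y)))
    (K.inChart x) (extChartAt I x x))

/-- The Lie derivative `L_{ξ(ε)} K(ε) = ∑ n, ε^n ∑_{i + j = n} L_{ξ_i} K_j` of formal series. -/
def lieSeries (ξ : ℕ → ∀ x : N, TangentSpace I x) (K : ℕ → GForm I N) : ℕ → GForm I N :=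
  fun n => ∑ a ∈ Finset.HasAntidiagonal.antidiagonal n, fun p => lieDeriv (ξ a.1) (K a.2 p)

/-- The series `exp (L_{ξ(ε)}) K = ∑ k, (1 / k!) L_{ξ(ε)}^k K` for a formal series `ξ(ε)` of vector
fields without constant term. Since `L_{ξ(ε)}^k K` is divisible by `ε^k`, only the summands with
`k ≤ n` contribute to the coefficient of `ε^n`. -/
def expLie (ξ : ℕ → ∀ x : N, TangentSpace I x) (K : GForm I N) : ℕ → GForm I N := fun n =>
  ∑ k ∈ Finset.range (n + 1), ((k.factorial : ℝ)⁻¹) • ((lieSeries ξ)^[k] (Pi.single 0 K)) n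

end Forms

/-! ### The V-data of a submanifold and the higher brackets -/

namespace Submanifold

variable {E E' : Type*} [NormedAddCommGroup E] [NormedSpace ℝ E] [FiniteDimensional ℝ E]
  [NormedAddCommGroup E'] [NormedSpace ℝ E'] [FiniteDimensional ℝ E'] {L M : Type*}
  [TopologicalSpace L] [ChartedSpace E L] [IsManifold 𝓘(ℝ, E) ∞ L]
  [TopologicalSpace M] [ChartedSpace E' M] [IsManifold 𝓘(ℝ, E') ∞ M]
  (S : Submanifold E E' L M)

/-- The total space `NL` of the normal bundle. -/
abbrev NL : Type _ := TotalSpace S.ModelFibre S.Normal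

/-- The model with corners of the manifold `NL`. -/
abbrev modelNL : ModelWithCorners ℝ (E × S.ModelFibre) (ModelProd E S.ModelFibre) :=
  𝓘(ℝ, E).prod 𝓘(ℝ, S.ModelFibre)

/-- Smooth sections of the normal bundle. -/
abbrev Section : Type _ := ContMDiffSection 𝓘(ℝ, E) S.ModelFibre ∞ S.Normal

/-- `NL`-valued differential `p`-forms on `L` (no regularity imposed). -/
abbrev NForm (p : ℕ) : Type _ := ∀ x : L, TangentSpace 𝓘(ℝ, E) x [⋀^Fin p]→L[ℝ] S.Normal x

/-- Elements of `Ω^*(L, NL)`, given by their components of degree `0, 1, 2, …`. -/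
abbrev GNForm : Type _ := ∀ p : ℕ, S.NForm p

/-- `L` is a `Ψ`-submanifold: `dim L ≥ p` and `pr ∘ Ψ|_L = 0` in `Ω^p(L, NL)`. -/
def IsPsiSubmanifold {p : ℕ} (Ψ : VForm 𝓘(ℝ, E') M p) : Prop :=
  p ≤ Module.finrank ℝ E ∧ ∀ x : L,
    ((S.pr x).compContinuousAlternatingMap (Ψ (S.incl x))).compContinuousLinearMap (S.dIncl x) = 0

/-- A tubular neighbourhood of `L` in `M`: a diffeomorphism of `NL` onto an open subset of `M` that
restricts to the inclusion of `L` on the zero section. -/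
structure TubularNeighborhood where
  /-- The map `τ : NL → M`. -/
  toFun : S.NL → M
  injective : Function.Injective toFun
  isLocalDiffeomorph : IsLocalDiffeomorph S.modelNL 𝓘(ℝ, E') ∞ toFun
  zeroSection : ∀ x : L, toFun ⟨x, 0⟩ = S.incl x

/-- The canonical identification of the fibre `N_x L`, `x = π(e)`, with the vertical tangent space at
`e`: the derivative at zero of `n ↦ e + n`, where the fibre is parametrized by the model fibre. -/
def verticalLift (e : S.NL) : S.Normal e.proj →L[ℝ] TangentSpace S.modelNL e :=
  (mfderiv 𝓘(ℝ, S.ModelFibre) S.modelNL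
    (fun f : S.ModelFibre => (⟨e.proj, e.2 +
      (trivializationAt S.ModelFibre S.Normal e.proj).symmL ℝ e.proj f⟩ : S.NL)) 0 :
    S.ModelFibre →L[ℝ] TangentSpace S.modelNL e).comp
  ((trivializationAt S.ModelFibre S.Normal e.proj).continuousLinearMapAt ℝ e.proj)

/-- The projection `T_{0_x} NL = T_x L ⊕ N_x L → N_x L`: the derivative of the fibre coordinate of a
local trivialization, followed by the inverse of this trivialization on `N_x L`. -/
def normalProj (x : L) : TangentSpace S.modelNL (⟨x, 0⟩ : S.NL) →L[ℝ] S.Normal x :=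
  ((trivializationAt S.ModelFibre S.Normal x).symmL ℝ x).comp
    (mfderiv S.modelNL 𝓘(ℝ, S.ModelFibre)
      (fun e : S.NL => (trivializationAt S.ModelFibre S.Normal x e).2) ⟨x, 0⟩ :
      TangentSpace S.modelNL (⟨x, 0⟩ : S.NL) →L[ℝ] S.ModelFibre)

/-- The inclusion `ι_L : Ω^p(L, NL) → Ω^p(NL, TNL)`, `ω ⊗ X ↦ π^* ω ⊗ X̂`, with `X̂` the vertical
lift of `X`. -/
def iota {p : ℕ} (a : S.NForm p) : VForm S.modelNL S.NL p := fun e =>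
  ((S.verticalLift e).compContinuousAlternatingMap (a e.proj)).compContinuousLinearMap
    (mfderiv S.modelNL 𝓘(ℝ, E) (TotalSpace.proj : S.NL → L) e)

/-- The vertical vector field `ι_L(s)` on `NL` of a section `s` of `NL`. -/
def iotaSection (s : S.Section) : ∀ e : S.NL, TangentSpace S.modelNL e := fun e =>
  S.verticalLift e (s e.proj)

/-- The projection `P_L : Ω^*(NL, TNL) → Ω^*(L, NL)`: restriction to the zero section followed by the
projection `TNL|_L → NL`. -/
def projL (K : GForm S.modelNL S.NL) : S.GNForm := fun p x =>
  ((S.normalProj x).compContinuousAlternatingMap (K p ⟨x, 0⟩)).compContinuousLinearMap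
    (mfderiv 𝓘(ℝ, E) S.modelNL (fun z : L => (⟨z, 0⟩ : S.NL)) x)

variable {S}

/-- The pullback `τ^* Ψ`. -/
def TubularNeighborhood.pullback (τ : S.TubularNeighborhood) {p : ℕ} (Ψ : VForm 𝓘(ℝ, E') M p) :
    VForm S.modelNL S.NL p := fun e =>
  ((mfderiv S.modelNL 𝓘(ℝ, E') τ.toFun e).inverse.compContinuousAlternatingMap
    (Ψ (τ.toFun e))).compContinuousLinearMap (mfderiv S.modelNL 𝓘(ℝ, E') τ.toFun e)

/-- The element `Δ = τ^* Ψ` of the graded Lie algebra `Ω^*(NL, TNL)`. -/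
def TubularNeighborhood.delta (τ : S.TubularNeighborhood) {p : ℕ} (Ψ : VForm 𝓘(ℝ, E') M p) :
    GForm S.modelNL S.NL :=
  Pi.single p (τ.pullback Ψ)

variable (S)

/-- A homogeneous element of `Ω^*(L, NL)` together with its form degree. -/
abbrev HomogeneousForm : Type _ := Σ p : ℕ, S.NForm p

variable {S}

/-- `ι_L` of a homogeneous element, as an element of the graded Lie algebra `Ω^*(NL, TNL)`. -/
def HomogeneousForm.iota (a : S.HomogeneousForm) : GForm S.modelNL S.NL :=
  Pi.single a.1 (S.iota a.2)

/-- The degree of a homogeneous element in the shifted space `Ω^*(L, NL)[-1]`. -/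
def HomogeneousForm.deg (a : S.HomogeneousForm) : ℕ := a.1 + 1

/-- A section of `NL` as a homogeneous element of `Ω^0(L, NL)`. -/
def ofSection (s : S.Section) : S.HomogeneousForm :=
  ⟨0, fun x => ContinuousAlternatingMap.constOfIsEmpty ℝ _ (Fin 0) (s x)⟩

/-- `[⋯[[Δ, ι_L a_1], ι_L a_2], ⋯, ι_L a_n]`. -/
def nestedBracket (Δ : GForm S.modelNL S.NL) :
    (n : ℕ) → (Fin n → S.HomogeneousForm) → GForm S.modelNL S.NL
  | 0, _ => Δ
  | n + 1, a => gBracket (nestedBracket Δ n fun i => a i.castSucc) (a (Fin.last n)).iota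

/-- The multibracket `l_n` of the `L_∞`-algebra `Ω^*(L, NL)[-1]` defined by the V-data with element
`Δ`, on homogeneous elements:
`l_n(a_1, …, a_n) = (-1)^⋆ P_L [⋯[[Δ, ι_L a_1], ι_L a_2], ⋯, ι_L a_n]`, where
`⋆ = (n - 1)|a_1| + (n - 2)|a_2| + ⋯ + |a_{n-1}| + n(n + 1)/2`. -/
def multibracket (Δ : GForm S.modelNL S.NL) (n : ℕ) (a : Fin n → S.HomogeneousForm) : S.GNForm :=
  (-1 : ℝ) ^ (∑ i : Fin n, (n - 1 - (i : ℕ)) * (a i).deg + n * (n + 1) / 2) •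
    S.projL (nestedBracket Δ n a)

variable (S)

/-- A formal deformation `s(ε) = ∑ i, ε^i s_i`, `s_i ∈ Γ(NL)`, `s_0 = 0`. -/
structure FormalDeformation where
  /-- The coefficients `s_i`. -/
  coeff : ℕ → S.Section
  coeff_zero : coeff 0 = 0

variable {S}

/-- The formal deformation `-s(ε)`. -/
instance : Neg S.FormalDeformation :=
  ⟨fun s => ⟨fun i => -s.coeff i, by rw [s.coeff_zero, neg_zero]⟩⟩

namespace FormalDeformation

/-- The series `P_L (exp (L_{ι_L(s(ε))}) Δ)` with coefficients in `Ω^*(L, NL)`. -/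
def formalF (s : S.FormalDeformation) (Δ : GForm S.modelNL S.NL) : ℕ → S.GNForm := fun n =>
  S.projL (expLie (fun i => S.iotaSection (s.coeff i)) Δ n)

/-- The coefficient of `ε^n` of `l_k(s(ε), …, s(ε))`, by multilinear extension. -/
def bracketCoeff (s : S.FormalDeformation) (Δ : GForm S.modelNL S.NL) (k n : ℕ) : S.GNForm :=
  ∑ i ∈ Finset.Nat.antidiagonalTuple k n, multibracket Δ k fun j => ofSection (s.coeff (i j))

/-- The Maurer-Cartan series `MC(s(ε)) = ∑_{k ≥ 1} (1 / k!) l_k(s(ε), …, s(ε))`. Since `s_0 = 0`, the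
series `l_k(s(ε), …, s(ε))` is divisible by `ε^k`, so only the summands with `k ≤ n` contribute to
the coefficient of `ε^n`. -/
def maurerCartan (s : S.FormalDeformation) (Δ : GForm S.modelNL S.NL) : ℕ → S.GNForm := fun n =>
  ∑ k ∈ Finset.Icc 1 n, ((k.factorial : ℝ)⁻¹) • s.bracketCoeff Δ k n

/-- `s(ε)` is a formal `Ψ`-deformation (with respect to `τ`):
`F_Ψ(s(ε)) = P_L (exp (L_{ι_L(s(ε))}) τ^*Ψ) = 0` as a formal series with coefficients in
`Ω^*(L, NL)`. -/
def IsFormalPsiDeformation (s : S.FormalDeformation) (τ : S.TubularNeighborhood) {p : ℕ}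
    (Ψ : VForm 𝓘(ℝ, E') M p) : Prop :=
  s.formalF (τ.delta Ψ) = 0

/-- `s(ε)` solves the formal Maurer-Cartan equation of the `L_∞`-algebra `Ω^*(L, NL)[-1]` associated
with `Ψ` and `τ`. -/
def IsMaurerCartan (s : S.FormalDeformation) (τ : S.TubularNeighborhood) {p : ℕ}
    (Ψ : VForm 𝓘(ℝ, E') M p) : Prop :=
  s.maurerCartan (τ.delta Ψ) = 0

end FormalDeformation

end Submanifold

end PsiDeformation

end

open PsiDeformation

/-!
The two formal series agree coefficient by coefficient as soon as `P_L Δ = 0`.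

The reason is that bracketing with a vector field is, up to sign, the Lie derivative:
`[K, X] = -L_X K` (`gBracket_vector`). Hence the nested bracket of `Δ` with `ι_L s_1, …, ι_L s_n` is
`(-1)^n L_{ι_L s_n} ⋯ L_{ι_L s_1} Δ`. Sections of `NL` have degree one in the shifted grading, so
`⋆ = n (n - 1) / 2 + n (n + 1) / 2 = n²`, and the signs cancel: `l_n(s_1, …, s_n)` is `P_L` of the
iterated Lie derivative (`multibracket_ofSection`). Expanding `L_{s(ε)}^k Δ` multilinearly
(`lieSeries_iterate`) identifies the `k`-th summand of the exponential series with the `k`-th summand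
of the Maurer-Cartan series for `k ≥ 1`. The summand `k = 0` is `P_L Δ`, which vanishes because `L`
is a `Ψ`-submanifold (`projL_delta`). Applied to `-s(ε)` this gives the second equivalence.

Brackets and Lie derivatives are defined pointwise in preferred charts through `fderiv`, so the
formula `[K, X] = -L_X K` and the additivity of `L_X` need differentiable arguments, at every stage
of an iteration. On a vector space `[K, X] = -L_X K` is Cartan's formula (`fnLocal_constOfIsEmpty`).
That `L_X K` is smooth for smooth `X` and `K` follows from its independence of the chart
(`inChart_lieDeriv`), a consequence of the naturality of the local Lie derivative, which rests on the
symmetry of second derivatives (`lieLocal_natural`). It remains to see that the vertical fields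
`ι_L s` (`isSmoothVector_iotaSection`) and the form `Δ = τ^* Ψ` (`isSmooth_pullback`) are smooth.
-/

open scoped Topology

noncomputable section

namespace PsiDeformation

/-! ### Insertion of vectors and Cartan's formula -/

section Degree

variable {V W : Type*} [AddCommGroup V] [Module ℝ V] [TopologicalSpace V]
  [AddCommGroup W] [Module ℝ W] [TopologicalSpace W]

@[simp]
theorem castDegree_rfl {p : ℕ} (h : p = p) (K : V [⋀^Fin p]→L[ℝ] W) : castDegree h K = K := rfl

@[simp]
theorem castDegree_castDegree {p q r : ℕ} (h : p = q) (h' : q = r) (K : V [⋀^Fin p]→L[ℝ] W) :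
    castDegree h' (castDegree h K) = castDegree (h.trans h') K := by
  subst h h'; rfl

theorem castDegree_apply {p q : ℕ} (h : p = q) (K : V [⋀^Fin p]→L[ℝ] W) (v : Fin q → V) :
    castDegree h K v = K (v ∘ Fin.cast h) := by
  subst h; rfl

@[simp]
theorem castDegree_zero {p q : ℕ} (h : p = q) : castDegree h (0 : V [⋀^Fin p]→L[ℝ] W) = 0 := by
  subst h; rfl

theorem castDegree_add [ContinuousAdd W] {p q : ℕ} (h : p = q) (K K' : V [⋀^Fin p]→L[ℝ] W) :
    castDegree h (K + K') = castDegree h K + castDegree h K' := by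
  subst h; rfl

end Degree

section Linear

variable {E G : Type*} [NormedAddCommGroup E] [NormedSpace ℝ E]
  [NormedAddCommGroup G] [NormedSpace ℝ G]

theorem extDeriv_castDegree {p q : ℕ} (h : p = q) (β : E → E [⋀^Fin p]→L[ℝ] G) (y : E) :
    extDeriv (fun z => castDegree h (β z)) y =
      castDegree (congrArg (· + 1) h) (extDeriv β y) := by
  subst h; rfl

theorem insertion_apply {p q : ℕ} (A : E [⋀^Fin p]→L[ℝ] E) (B : E [⋀^Fin (q + 1)]→L[ℝ] G)
    (v : Fin (p + q) → E) :
    insertion A B v = ((p.factorial * q.factorial : ℝ)⁻¹) •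
      ∑ σ : Equiv.Perm (Fin (p + q)), Equiv.Perm.sign σ •
        B (Fin.cons (A fun i => v (σ (Fin.castAdd q i))) fun j => v (σ (Fin.natAdd p j))) := by
  rw [insertion, ContinuousAlternatingMap.smul_apply,
    ContinuousMultilinearMap.alternatization_apply_apply]
  rfl

/-- Inserting a `0`-form, that is a vector `X`, is the interior product `B ↦ B(X, ·)`. -/
theorem insertion_constOfIsEmpty {q : ℕ} (X : E) (B : E [⋀^Fin (q + 1)]→L[ℝ] G) :
    insertion (ContinuousAlternatingMap.constOfIsEmpty ℝ E (Fin 0) X) B =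
      castDegree (Nat.zero_add q).symm (B.curryLeft X) := by
  ext v
  rw [insertion_apply, castDegree_apply]
  have hterm : ∀ σ : Equiv.Perm (Fin (0 + q)), Equiv.Perm.sign σ •
      B (Fin.cons ((ContinuousAlternatingMap.constOfIsEmpty ℝ E (Fin 0) X)
        fun i => v (σ (Fin.castAdd q i))) fun j => v (σ (Fin.natAdd 0 j))) =
      castDegree (Nat.zero_add q).symm (B.curryLeft X) v := by
    intro σ
    have h := (castDegree (Nat.zero_add q).symm (B.curryLeft X)).toAlternatingMap.map_perm v σ
    have h2 : (castDegree (Nat.zero_add q).symm (B.curryLeft X)) (v ∘ σ) =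
        Equiv.Perm.sign σ • castDegree (Nat.zero_add q).symm (B.curryLeft X) v := h
    rw [castDegree_apply] at h2
    have h3 : B (Fin.cons ((ContinuousAlternatingMap.constOfIsEmpty ℝ E (Fin 0) X)
        fun i => v (σ (Fin.castAdd q i))) fun j => v (σ (Fin.natAdd 0 j))) =
        B.curryLeft X ((v ∘ σ) ∘ Fin.cast (Nat.zero_add q).symm) := by
      rw [ContinuousAlternatingMap.curryLeft_apply_apply]
      congr 2
      funext j
      exact congrArg (fun k => v (σ k)) (Fin.ext (by simp))
    rw [h3, h2, smul_smul, Int.units_mul_self, one_smul]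
  -- The `q!` equal summands cancel the normalizing factor `1 / (0! q!)`.
  rw [Finset.sum_congr rfl fun σ _ => hterm σ, castDegree_apply, Finset.sum_const,
    Finset.card_univ, Fintype.card_perm, Fintype.card_fin, ← Nat.cast_smul_eq_nsmul ℝ, smul_smul,
    Nat.factorial_zero, Nat.cast_one, one_mul, congrArg Nat.factorial (Nat.zero_add q),
    inv_mul_cancel₀ (by positivity), one_smul]

/-- Inserting a vector valued form into a linear map is composition. -/
theorem insertion_one_form {p : ℕ} (A : E [⋀^Fin p]→L[ℝ] E) (B : E →L[ℝ] G) :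
    insertion A (q := 0) (ContinuousAlternatingMap.ofSubsingleton ℝ E G (0 : Fin 1) B) =
      B.compContinuousAlternatingMap A := by
  ext v
  rw [insertion_apply]
  have hterm : ∀ σ : Equiv.Perm (Fin (p + 0)), Equiv.Perm.sign σ •
      (ContinuousAlternatingMap.ofSubsingleton ℝ E G (0 : Fin 1) B)
        (Fin.cons (A fun i => v (σ (Fin.castAdd 0 i))) fun j => v (σ (Fin.natAdd p j))) =
      B (A v) := by
    intro σ
    have h : A (v ∘ σ) = Equiv.Perm.sign σ • A v := A.toAlternatingMap.map_perm v σ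
    have h3 : (ContinuousAlternatingMap.ofSubsingleton ℝ E G (0 : Fin 1) B)
        (Fin.cons (A fun i => v (σ (Fin.castAdd 0 i))) fun j => v (σ (Fin.natAdd p j))) =
        B (A (v ∘ σ)) := rfl
    rw [h3, h, ← B.coe_coe, LinearMap.map_smul_of_tower, smul_smul, Int.units_mul_self, one_smul]
  rw [Finset.sum_congr rfl fun σ _ => hterm σ, Finset.sum_const,
    Finset.card_univ, Fintype.card_perm, Fintype.card_fin, ← Nat.cast_smul_eq_nsmul ℝ, smul_smul,
    Nat.factorial_zero, Nat.cast_one, mul_one, congrArg Nat.factorial (Nat.add_zero p),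
    inv_mul_cancel₀ (by positivity), one_smul]
  rfl

/-- `derivationAction` is the derivative of `g ↦ g^* K` at the identity; in this form it is visibly a
continuous bilinear expression in `A` and `K`. -/
theorem derivationAction_eq {p : ℕ} (A : E →L[ℝ] E) (K : E [⋀^Fin p]→L[ℝ] E) :
    derivationAction A K = ContinuousAlternatingMap.fderivCompContinuousLinearMapCLM E
      (ContinuousLinearMap.id ℝ E) K A := by
  ext v
  rw [ContinuousAlternatingMap.fderivCompContinuousLinearMapCLM_apply,
    ContinuousAlternatingMap.fderivCompContinuousLinearMap_apply]
  change (∑ i, K.toContinuousMultilinearMap.compContinuousLinearMap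
      (Function.update (fun _ => ContinuousLinearMap.id ℝ E) i A)) v = _
  simp only [sum_apply]
  rfl

theorem derivationAction_apply {p : ℕ} (A : E →L[ℝ] E) (K : E [⋀^Fin p]→L[ℝ] E)
    (v : Fin p → E) : derivationAction A K v = ∑ i, K (Function.update v i (A (v i))) := by
  rw [derivationAction_eq, ContinuousAlternatingMap.fderivCompContinuousLinearMapCLM_apply,
    ContinuousAlternatingMap.fderivCompContinuousLinearMap_apply]
  refine Finset.sum_congr rfl fun i _ => congrArg K (funext fun j => ?_)
  rcases eq_or_ne j i with rfl | h
  · simp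
  · simp [h]

theorem lieLocal_apply {p : ℕ} (X : E → E) (K : E → E [⋀^Fin p]→L[ℝ] E) (y : E)
    (v : Fin p → E) :
    lieLocal X K y v = fderiv ℝ K y (X y) v - fderiv ℝ X y (K y v) +
      ∑ i, K y (Function.update v i (fderiv ℝ X y (v i))) := by
  rw [← derivationAction_apply]
  rfl

/-- Evaluation of a form on fixed vectors commutes with differentiation. -/
theorem fderiv_alternatingMap_apply {p : ℕ} {K : E → E [⋀^Fin p]→L[ℝ] G} {y : E}
    (hK : DifferentiableAt ℝ K y) (v : Fin p → E) (w : E) :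
    fderiv ℝ (fun z => K z v) y w = fderiv ℝ K y w v := by
  have := fderiv_continuousAlternatingMap_apply_apply hK (g := fun i _ => v i)
    (fun i => differentiableAt_const _) w
  simpa using this

set_option synthInstance.maxHeartbeats 100000 in
/-- Cartan's formula for a form of positive degree on a vector space. -/
theorem cartan_formula {q : ℕ} {X : E → E} {K : E → E [⋀^Fin (q + 1)]→L[ℝ] G} {y : E}
    (hX : DifferentiableAt ℝ X y) (hK : DifferentiableAt ℝ K y) (v : Fin (q + 1) → E) :
    (extDeriv K y).curryLeft (X y) v + extDeriv (fun z => (K z).curryLeft (X z)) y v =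
      fderiv ℝ K y (X y) v + ∑ i, K y (Function.update v i (fderiv ℝ X y (v i))) := by
  have hK' : DifferentiableAt ℝ (fun z => (K z).curryLeft) y := by
    refine DifferentiableAt.comp
      (g := fun B : E [⋀^Fin (q + 1)]→L[ℝ] G => B.curryLeft) y ?_ hK
    exact (ContinuousAlternatingMap.curryLeftLI (𝕜 := ℝ) (E := E) (F := G)
        (n := q)).toContinuousLinearMap.differentiableAt
  have hXK : DifferentiableAt ℝ (fun z => (K z).curryLeft (X z)) y :=
    hK'.clm_apply hX
  have hterm : ∀ i : Fin (q + 1),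
      fderiv ℝ (fun z => (K z).curryLeft (X z) (i.removeNth v)) y (v i) =
      fderiv ℝ K y (v i) (Fin.cons (X y) (i.removeNth v)) +
        K y (Fin.cons (fderiv ℝ X y (v i)) (i.removeNth v)) := by
    intro i
    have hg : ∀ j : Fin (q + 1), DifferentiableAt ℝ
        (fun z => (Fin.cons (X z) (i.removeNth v) : Fin (q + 1) → E) j) y := by
      intro j
      refine Fin.cases ?_ (fun k => ?_) j
      · simpa using hX
      · simp
    have := fderiv_continuousAlternatingMap_apply_apply hK hg (v i)
    refine Eq.trans this ?_
    congr 1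
    rw [Fin.sum_univ_succ, Finset.sum_eq_zero, add_zero]
    · simp only [Fin.cons_zero]
      congr 1
      exact Fin.update_cons_zero (α := fun _ => E) _ _ _
    · intro k _
      simp only [Fin.cons_succ, fderiv_const_apply, zero_apply]
      exact (K y).toAlternatingMap.map_update_zero _ _
  have hcons : ∀ i : Fin (q + 1), (-1 : ℤ) ^ (i : ℕ) •
      K y (Fin.cons (fderiv ℝ X y (v i)) (i.removeNth v)) =
      K y (Function.update v i (fderiv ℝ X y (v i))) := by
    intro i
    have := (K y).map_insertNth i (fderiv ℝ X y (v i)) (i.removeNth v)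
    rw [Fin.insertNth_removeNth] at this
    exact this.symm
  rw [ContinuousAlternatingMap.curryLeft_apply_apply, extDeriv_apply hK, extDeriv_apply hXK,
    Fin.sum_univ_succ, add_assoc, ← Finset.sum_add_distrib]
  congr 1
  · simp only [Fin.val_zero, pow_zero, one_smul]
    rw [fderiv_alternatingMap_apply hK]
    rfl
  · refine Finset.sum_congr rfl fun i _ => ?_
    rw [hterm, ← hcons, fderiv_alternatingMap_apply hK, smul_add, ← add_assoc]
    have : (i.succ).removeNth (Matrix.vecCons (X y) v) =
        (Fin.cons (X y) (i.removeNth v) : Fin (q + 1) → E) := by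
      funext j
      refine Fin.cases ?_ (fun k => ?_) j
      · simp [Fin.removeNth]
      · simp [Fin.removeNth]
    rw [this]
    simp [pow_succ]

/-- The Frölicher-Nijenhuis bracket with a vector field on a vector space: `[K, X] = -L_X K`. The term
`𝓛_X K` is computed by Cartan's formula, and `𝓛_K X = DX ∘ K`. -/
theorem fnLocal_constOfIsEmpty {p : ℕ} {X : E → E} {K : E → E [⋀^Fin p]→L[ℝ] E} {y : E}
    (hX : DifferentiableAt ℝ X y) (hK : DifferentiableAt ℝ K y) :
    fnLocal K (fun z => ContinuousAlternatingMap.constOfIsEmpty ℝ E (Fin 0) (X z)) y =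
      -lieLocal X K y := by
  have h1 : nijenhuisLie K (fun z => ContinuousAlternatingMap.constOfIsEmpty ℝ E (Fin 0) (X z)) y =
      (fderiv ℝ X y).compContinuousAlternatingMap (K y) := by
    rw [nijenhuisLie, extDeriv_constOfIsEmpty]
    exact insertion_one_form _ _
  have h2 : ∀ v, castDegree (Nat.zero_add p) (nijenhuisLie
      (fun z => ContinuousAlternatingMap.constOfIsEmpty ℝ E (Fin 0) (X z)) K y) v =
      fderiv ℝ K y (X y) v + ∑ i, K y (Function.update v i (fderiv ℝ X y (v i))) := by
    intro v
    cases p with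
    | zero =>
      rw [nijenhuisLie, insertion_constOfIsEmpty, castDegree_castDegree, castDegree_rfl,
        ContinuousAlternatingMap.curryLeft_apply_apply, extDeriv_apply hK]
      simp [fderiv_alternatingMap_apply hK]
    | succ q =>
      simp only [nijenhuisLie, pow_zero, one_smul, insertion_constOfIsEmpty]
      rw [extDeriv_castDegree, castDegree_add, castDegree_castDegree, castDegree_rfl,
        castDegree_castDegree]
      exact cartan_formula hX hK v
  ext v
  have h3 : fnLocal K (fun z => ContinuousAlternatingMap.constOfIsEmpty ℝ E (Fin 0) (X z)) y v =
      (fderiv ℝ X y) (K y v) - castDegree (Nat.zero_add p) (nijenhuisLie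
      (fun z => ContinuousAlternatingMap.constOfIsEmpty ℝ E (Fin 0) (X z)) K y) v := by
    rw [fnLocal, h1, Nat.mul_zero, pow_zero, one_smul]
    rfl
  refine h3.trans ?_
  rw [h2 v]
  change _ = -(lieLocal X K y v)
  rw [lieLocal_apply]
  abel

end Linear

/-! ### The local Lie derivative: naturality, smoothness and additivity -/

section Linear

variable {E E' G : Type*} [NormedAddCommGroup E] [NormedSpace ℝ E]
  [NormedAddCommGroup E'] [NormedSpace ℝ E'] [NormedAddCommGroup G] [NormedSpace ℝ G]

/-- The local Lie derivative is natural: if `X, X'` and `K, K'` are `φ`-related near `y`, then so are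
the Lie derivatives at `y`. The terms containing the second derivative of `φ` cancel by its symmetry.
The map `φ` need not be invertible. -/
theorem lieLocal_natural {p : ℕ} {φ : E → E'} {X : E → E} {X' : E' → E'}
    {K : E → E [⋀^Fin p]→L[ℝ] E} {K' : E' → E' [⋀^Fin p]→L[ℝ] E'} {y : E}
    (hφ : ContDiffAt ℝ ∞ φ y) (hX : DifferentiableAt ℝ X y) (hX' : DifferentiableAt ℝ X' (φ y))
    (hK : DifferentiableAt ℝ K y) (hK' : DifferentiableAt ℝ K' (φ y))
    (hXX' : ∀ᶠ z in 𝓝 y, fderiv ℝ φ z (X z) = X' (φ z))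
    (hKK' : ∀ᶠ z in 𝓝 y, ∀ v, fderiv ℝ φ z (K z v) = K' (φ z) fun i => fderiv ℝ φ z (v i))
    (v : Fin p → E) :
    fderiv ℝ φ y (lieLocal X K y v) = lieLocal X' K' (φ y) fun i => fderiv ℝ φ y (v i) := by
  have hφ1 : DifferentiableAt ℝ φ y := hφ.differentiableAt (by simp)
  have hφ2 : DifferentiableAt ℝ (fderiv ℝ φ) y :=
    (hφ.fderiv_right (m := 1) (by norm_cast)).differentiableAt (by simp)
  have hsymm : ∀ a b, fderiv ℝ (fderiv ℝ φ) y a b = fderiv ℝ (fderiv ℝ φ) y b a :=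
    hφ.isSymmSndFDerivAt (by simp; norm_cast)
  -- Differentiate the relation `Dφ X = X' ∘ φ` in the direction `w`.
  have e1 : ∀ w, fderiv ℝ (fderiv ℝ φ) y w (X y) + fderiv ℝ φ y (fderiv ℝ X y w) =
      fderiv ℝ X' (φ y) (fderiv ℝ φ y w) := by
    intro w
    have h := congrArg (fun T => T w) (Filter.EventuallyEq.fderiv_eq (𝕜 := ℝ) hXX')
    beta_reduce at h
    rw [fderiv_clm_apply hφ2 hX, fderiv_fun_comp y hX' hφ1] at h
    simpa [add_comm] using h
  -- Differentiate the relation between `K` and `K'`, evaluated at fixed vectors `v`, along `X`.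
  have e2 : fderiv ℝ (fderiv ℝ φ) y (X y) (K y v) + fderiv ℝ φ y (fderiv ℝ K y (X y) v) =
      fderiv ℝ K' (φ y) (fderiv ℝ φ y (X y)) (fun i => fderiv ℝ φ y (v i)) +
        ∑ i, K' (φ y) (Function.update (fun i => fderiv ℝ φ y (v i)) i
          (fderiv ℝ (fderiv ℝ φ) y (X y) (v i))) := by
    have hKv : DifferentiableAt ℝ (fun z => K z v) y :=
      hK.continuousAlternatingMap_apply fun i => differentiableAt_const _
    have h := congrArg (fun T => T (X y))
      (Filter.EventuallyEq.fderiv_eq (𝕜 := ℝ) (hKK'.mono fun z hz => hz v))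
    beta_reduce at h
    have hr := fderiv_continuousAlternatingMap_apply_apply (f := fun z => K' (φ z))
      (g := fun i z => fderiv ℝ φ z (v i)) (hK'.comp y hφ1)
      (fun i => hφ2.clm_apply (differentiableAt_const _)) (X y)
    rw [fderiv_clm_apply hφ2 hKv, hr, fderiv_fun_comp y hK' hφ1] at h
    simp only [fderiv_clm_apply hφ2 (differentiableAt_const _)] at h
    simpa [fderiv_alternatingMap_apply hK, add_comm] using h
  have hXy := hXX'.self_of_nhds
  have hKy := hKK'.self_of_nhds
  have hupd : ∀ i w, (fun j => fderiv ℝ φ y (Function.update v i w j)) =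
      Function.update (fun j => fderiv ℝ φ y (v j)) i (fderiv ℝ φ y w) := by
    intro i w
    funext j
    rcases eq_or_ne j i with rfl | h
    · simp
    · simp [h]
  rw [lieLocal_apply, lieLocal_apply, map_add, map_sub, map_sum, ← hKy, ← e1, ← hXy]
  simp only [hKy (Function.update v _ _), hupd, ← e1]
  have hadd : ∀ i, K' (φ y) (Function.update (fun j => fderiv ℝ φ y (v j)) i
        (fderiv ℝ (fderiv ℝ φ) y (v i) (X y) + fderiv ℝ φ y (fderiv ℝ X y (v i)))) =
      K' (φ y) (Function.update (fun j => fderiv ℝ φ y (v j)) i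
        (fderiv ℝ (fderiv ℝ φ) y (v i) (X y))) +
      K' (φ y) (Function.update (fun j => fderiv ℝ φ y (v j)) i
        (fderiv ℝ φ y (fderiv ℝ X y (v i)))) := fun i => (K' (φ y)).map_update_add _ _ _ _
  simp only [hadd, Finset.sum_add_distrib]
  -- The remaining terms match by the symmetry of `D²φ`.
  simp only [hsymm (X y)] at e2
  rw [← eq_sub_iff_add_eq'] at e2
  rw [e2]
  abel

theorem contDiffOn_lieLocal {p : ℕ} {X : E → E} {K : E → E [⋀^Fin p]→L[ℝ] E} {U : Set E}
    (hU : IsOpen U) (hX : ContDiffOn ℝ ∞ X U) (hK : ContDiffOn ℝ ∞ K U) :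
    ContDiffOn ℝ ∞ (lieLocal X K) U := by
  have hX' : ContDiffOn ℝ ∞ (fderiv ℝ X) U := hX.fderiv_of_isOpen hU (by simp)
  have hK' : ContDiffOn ℝ ∞ (fderiv ℝ K) U := hK.fderiv_of_isOpen hU (by simp)
  have h2 : ContDiffOn ℝ ∞ (fun y => ContinuousLinearMap.compContinuousAlternatingMapCLM ℝ E E E
      (Fin p) (fderiv ℝ X y) (K y)) U :=
    (contDiffOn_const.clm_apply hX').clm_apply hK
  have h3 : ContDiffOn ℝ ∞ (fun y => ContinuousAlternatingMap.fderivCompContinuousLinearMapCLM E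
      (ContinuousLinearMap.id ℝ E) (K y) (fderiv ℝ X y)) U :=
    (contDiffOn_const.clm_apply hK).clm_apply hX'
  refine (((hK'.clm_apply hX).sub h2).add h3).congr fun y _ => ?_
  rw [lieLocal, derivationAction_eq]
  rfl

theorem lieLocal_sum {p : ℕ} {ι : Type*} (s : Finset ι) (X : E → E)
    (K : ι → E → E [⋀^Fin p]→L[ℝ] E) {y : E} (hK : ∀ i ∈ s, DifferentiableAt ℝ (K i) y) :
    lieLocal X (fun z => ∑ i ∈ s, K i z) y = ∑ i ∈ s, lieLocal X (K i) y := by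
  simp only [lieLocal, derivationAction_eq, map_sum, fderiv_fun_sum hK,
    Finset.sum_add_distrib, Finset.sum_sub_distrib, sum_apply]
  congr 2
  exact map_sum (ContinuousLinearMap.compContinuousAlternatingMapCLM ℝ E E E
      (Fin p) (fderiv ℝ X y)) _ _

/-- In finite dimensions smoothness of a family of alternating maps can be tested in the larger space of
multilinear maps, since a subspace of a finite-dimensional space has a continuous projection. -/
theorem contDiffAt_of_toContinuousMultilinearMap [FiniteDimensional ℝ E]
    [FiniteDimensional ℝ G] {p : ℕ} {F : Type*} [NormedAddCommGroup F] [NormedSpace ℝ F] {f : F → E [⋀^Fin p]→L[ℝ] G} {y : F}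
    (h : ContDiffAt ℝ ∞ (fun z => (f z).toContinuousMultilinearMap) y) : ContDiffAt ℝ ∞ f y := by
  have : FiniteDimensional ℝ (ContinuousMultilinearMap ℝ (fun _ : Fin p => E) G) :=
    FiniteDimensional.of_injective
      (ContinuousMultilinearMap.toMultilinearMapLinear (R' := ℝ) (A := ℝ))
      fun f g h => by
        ext v
        exact congrArg (fun T : MultilinearMap ℝ (fun _ : Fin p => E) G => T v) h
  obtain ⟨g, hg⟩ := LinearMap.exists_leftInverse_of_injective
    (ContinuousAlternatingMap.toContinuousMultilinearMapCLM (𝕜 := ℝ) (E := E) (F := G)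
      (ι := Fin p) ℝ).toLinearMap
    (LinearMap.ker_eq_bot.2 ContinuousAlternatingMap.toContinuousMultilinearMap_injective)
  have := (LinearMap.toContinuousLinearMap g).contDiff.contDiffAt.comp (n := ∞) y h
  refine this.congr_of_eventuallyEq (Filter.Eventually.of_forall fun z => ?_)
  exact (LinearMap.congr_fun hg (f z)).symm

/-- Composing a smooth form with smooth families of linear maps on both sides gives a smooth form. -/
theorem contDiffAt_formPullback [FiniteDimensional ℝ E] [FiniteDimensional ℝ G] {p : ℕ}
    {F : Type*} [NormedAddCommGroup F] [NormedSpace ℝ F]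
    {K : F → E' [⋀^Fin p]→L[ℝ] E'} {A : F → E →L[ℝ] E'} {B : F → E' →L[ℝ] G} {y : F}
    (hK : ContDiffAt ℝ ∞ K y) (hA : ContDiffAt ℝ ∞ A y) (hB : ContDiffAt ℝ ∞ B y) :
    ContDiffAt ℝ ∞ (fun z =>
      ((B z).compContinuousAlternatingMap (K z)).compContinuousLinearMap (A z)) y := by
  have h1 : ContDiffAt ℝ ∞ (fun z => ContinuousLinearMap.compContinuousAlternatingMapCLM ℝ E' E' G
      (Fin p) (B z) (K z)) y :=
    (contDiffAt_const.clm_apply hB).clm_apply hK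
  have h2 := (ContinuousAlternatingMap.toContinuousMultilinearMapCLM (𝕜 := ℝ) (E := E') (F := G)
      (ι := Fin p) ℝ).contDiff.contDiffAt.comp (n := ∞) y h1
  have h3 : ContDiffAt ℝ ∞
      (fun z => ContinuousMultilinearMap.compContinuousLinearMapContinuousMultilinear ℝ
        (fun _ : Fin p => E) (fun _ : Fin p => E') G fun _ => A z) y :=
    (ContinuousMultilinearMap.contDiff _).contDiffAt.comp (n := ∞) y
      (contDiffAt_pi.2 fun _ => hA)
  exact contDiffAt_of_toContinuousMultilinearMap (h3.clm_apply h2)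

end Linear

/-! ### Lie derivatives and brackets on a manifold -/

section Linear

variable {E G : Type*} [NormedAddCommGroup E] [NormedSpace ℝ E]
  [NormedAddCommGroup G] [NormedSpace ℝ G]

theorem insertion_zero_left {p q : ℕ} (B : E [⋀^Fin (q + 1)]→L[ℝ] G) :
    insertion (0 : E [⋀^Fin p]→L[ℝ] E) B = 0 := by
  ext v
  rw [insertion_apply]
  refine (smul_eq_zero_of_right _ (Finset.sum_eq_zero fun σ _ => ?_)).trans rfl
  exact smul_eq_zero_of_right _ (B.toAlternatingMap.map_coord_zero 0 rfl)

theorem insertion_zero_right {p q : ℕ} (A : E [⋀^Fin p]→L[ℝ] E) :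
    insertion A (0 : E [⋀^Fin (q + 1)]→L[ℝ] G) = 0 := by
  ext v
  rw [insertion_apply]
  exact smul_eq_zero_of_right _ (Finset.sum_eq_zero fun σ _ => smul_zero _)

theorem extDeriv_const_zero {q : ℕ} (y : E) :
    extDeriv (fun _ => (0 : E [⋀^Fin q]→L[ℝ] G)) y = 0 := by
  ext v
  rw [extDeriv_apply (differentiableAt_const _)]
  simp

theorem fnLocal_zero_right {p q : ℕ} (K : E → E [⋀^Fin p]→L[ℝ] E) (y : E) :
    fnLocal K (fun _ => (0 : E [⋀^Fin q]→L[ℝ] E)) y = 0 := by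
  have h1 : nijenhuisLie K (fun _ => (0 : E [⋀^Fin q]→L[ℝ] E)) y = 0 := by
    cases q with
    | zero => rw [nijenhuisLie, extDeriv_const_zero, insertion_zero_right]
    | succ q =>
      rw [nijenhuisLie, extDeriv_const_zero, insertion_zero_right, zero_add]
      simp only [insertion_zero_right]
      rw [extDeriv_const_zero, smul_zero]
  have h2 : nijenhuisLie (fun _ => (0 : E [⋀^Fin q]→L[ℝ] E)) K y = 0 := by
    cases p with
    | zero => rw [nijenhuisLie, insertion_zero_left]
    | succ q =>
      rw [nijenhuisLie, insertion_zero_left, zero_add]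
      simp only [insertion_zero_left]
      rw [extDeriv_const_zero, smul_zero]
  rw [fnLocal, h1, h2, castDegree_zero, smul_zero, sub_zero]

end Linear

section Forms

variable {E H : Type*} [NormedAddCommGroup E] [NormedSpace ℝ E] [TopologicalSpace H]
  {I : ModelWithCorners ℝ E H} {N : Type*} [TopologicalSpace N] [ChartedSpace H N]

/-- The vector field `X` in the preferred chart around `x₀`. -/
def vectorInChart (X : ∀ x : N, TangentSpace I x) (x₀ : N) (y : E) : E :=
  chartDeriv x₀ ((extChartAt I x₀).symm y) (X ((extChartAt I x₀).symm y))

/-- Smoothness of a vector field on a manifold without boundary. -/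
def IsSmoothVector (X : ∀ x : N, TangentSpace I x) : Prop :=
  ∀ x₀ : N, ContDiffOn ℝ ∞ (vectorInChart X x₀) (extChartAt I x₀).target

theorem VForm.inChart_apply {p : ℕ} (K : VForm I N p) (x₀ : N) (y : E) (v : Fin p → E) :
    K.inChart x₀ y v = chartDeriv (I := I) x₀ ((extChartAt I x₀).symm y)
      (K ((extChartAt I x₀).symm y)
        fun i => (chartDeriv (I := I) x₀ ((extChartAt I x₀).symm y)).inverse (v i)) := rfl

theorem vectorInChart_extChartAt (X : ∀ x : N, TangentSpace I x) {x₀ x : N}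
    (hx : x ∈ (extChartAt I x₀).source) :
    vectorInChart X x₀ (extChartAt I x₀ x) = chartDeriv x₀ x (X x) := by
  rw [vectorInChart, (extChartAt I x₀).left_inv hx]

theorem ofChart_apply {p : ℕ} (x : N) (K : E [⋀^Fin p]→L[ℝ] E)
    (v : Fin p → TangentSpace I x) :
    ofChart x K v = (chartDeriv (I := I) x x).inverse (K fun i => chartDeriv (I := I) x x (v i)) :=
  rfl

theorem ofChart_neg {p : ℕ} (x : N) (K : E [⋀^Fin p]→L[ℝ] E) :
    ofChart (I := I) x (-K) = -ofChart (I := I) x K := by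
  ext v
  exact map_neg (chartDeriv (I := I) x x).inverse _

theorem ofChart_zero {p : ℕ} (x : N) :
    ofChart (I := I) x (0 : E [⋀^Fin p]→L[ℝ] E) = 0 := by
  ext v
  exact map_zero (chartDeriv (I := I) x x).inverse

theorem ofChart_sum {p : ℕ} {ι : Type*} (s : Finset ι) (x : N) (K : ι → E [⋀^Fin p]→L[ℝ] E) :
    ofChart (I := I) x (∑ i ∈ s, K i) = ∑ i ∈ s, ofChart (I := I) x (K i) := by
  ext v
  rw [ofChart_apply, ContinuousAlternatingMap.sum_apply, ContinuousAlternatingMap.sum_apply]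
  exact map_sum _ _ _

section Smooth

variable [IsManifold I ∞ N]

theorem chartDeriv_isInvertible {x₀ x : N} (hx : x ∈ (extChartAt I x₀).source) :
    (chartDeriv (I := I) x₀ x).IsInvertible := by
  have : IsManifold I 1 N := .of_le (n := ∞) (by norm_cast)
  exact isInvertible_mfderiv_extChartAt hx

theorem inverse_chartDeriv {x₀ x : N} (hx : x ∈ (extChartAt I x₀).source)
    (v : TangentSpace I x) :
    (chartDeriv (I := I) x₀ x).inverse (chartDeriv (I := I) x₀ x v) = v :=
  (chartDeriv_isInvertible hx).inverse_apply_self v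

theorem chartDeriv_inverse {x₀ x : N} (hx : x ∈ (extChartAt I x₀).source) (v : E) :
    chartDeriv (I := I) x₀ x ((chartDeriv (I := I) x₀ x).inverse v) = v :=
  (chartDeriv_isInvertible hx).self_apply_inverse v

variable {E' H' : Type*} [NormedAddCommGroup E'] [NormedSpace ℝ E'] [TopologicalSpace H']
  {I' : ModelWithCorners ℝ E' H'} {N' : Type*} [TopologicalSpace N'] [ChartedSpace H' N']
  [IsManifold I' ∞ N'] [I.Boundaryless]

theorem contDiffAt_writtenInCharts {f : N → N'} {x₀ x : N} {x₁ : N'}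
    (hx : x ∈ (extChartAt I x₀).source) (hfx : f x ∈ (extChartAt I' x₁).source)
    (hf : ContMDiffAt I I' ∞ f x) :
    ContDiffAt ℝ ∞ (fun z => extChartAt I' x₁ (f ((extChartAt I x₀).symm z)))
      (extChartAt I x₀ x) := by
  have h1 : ContMDiffAt 𝓘(ℝ, E) I ∞ (extChartAt I x₀).symm (extChartAt I x₀ x) :=
    (contMDiffOn_extChartAt_symm x₀).contMDiffAt
      ((isOpen_extChartAt_target x₀).mem_nhds ((extChartAt I x₀).map_source hx))
  have hl := (extChartAt I x₀).left_inv hx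
  have h2 : ContMDiffAt I' 𝓘(ℝ, E') ∞ (extChartAt I' x₁) (f x) :=
    contMDiffAt_extChartAt' (by rwa [← extChartAt_source I'])
  have h3 := h2.comp x hf
  rw [← hl] at h3
  exact contMDiffAt_iff_contDiffAt.1 (h3.comp (extChartAt I x₀ x) h1)

/-- The chain rule for a map written in the preferred charts around `x₀` and `x₁`. -/
theorem fderiv_writtenInCharts {f : N → N'} {x₀ x : N} {x₁ : N'}
    (hx : x ∈ (extChartAt I x₀).source) (hfx : f x ∈ (extChartAt I' x₁).source)
    (hf : ContMDiffAt I I' ∞ f x) (v : TangentSpace I x) :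
    fderiv ℝ (fun z => extChartAt I' x₁ (f ((extChartAt I x₀).symm z))) (extChartAt I x₀ x)
      (chartDeriv x₀ x v) = chartDeriv x₁ (f x) (mfderiv I I' f x v) := by
  have hφ := contDiffAt_writtenInCharts hx hfx hf
  have h2 : MDifferentiableAt I' 𝓘(ℝ, E') (extChartAt I' x₁) (f x) :=
    (contMDiffAt_extChartAt' (n := ∞) (by rwa [← extChartAt_source I'])).mdifferentiableAt (by simp)
  have h0 : MDifferentiableAt I 𝓘(ℝ, E) (extChartAt I x₀) x :=
    (contMDiffAt_extChartAt' (n := ∞) (by rwa [← extChartAt_source I])).mdifferentiableAt (by simp)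
  have heq : (fun z => extChartAt I' x₁ (f ((extChartAt I x₀).symm z))) ∘ extChartAt I x₀ =ᶠ[𝓝 x]
      extChartAt I' x₁ ∘ f := by
    filter_upwards [(isOpen_extChartAt_source x₀).mem_nhds hx] with z hz
    rw [Function.comp_apply, Function.comp_apply, (extChartAt I x₀).left_inv hz]
  have h := heq.mfderiv_eq (I := I) (I' := 𝓘(ℝ, E'))
  rw [mfderiv_comp x (hφ.differentiableAt (by simp)).mdifferentiableAt h0,
    mfderiv_comp x h2 (hf.mdifferentiableAt (by simp)), mfderiv_eq_fderiv] at h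
  exact congrArg (fun T => T v) h

/-- The Lie derivative does not depend on the charts. -/
theorem inChart_lieDeriv {p : ℕ} {X : ∀ x : N, TangentSpace I x} {K : VForm I N p}
    (hX : IsSmoothVector X) (hK : K.IsSmooth) {x₀ : N} {y : E}
    (hy : y ∈ (extChartAt I x₀).target) :
    (lieDeriv X K).inChart x₀ y = lieLocal (vectorInChart X x₀) (K.inChart x₀) y := by
  obtain ⟨x, hx, rfl⟩ : ∃ x ∈ (extChartAt I x₀).source, extChartAt I x₀ x = y :=
    ⟨_, (extChartAt I x₀).map_target hy, (extChartAt I x₀).right_inv hy⟩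
  have hxx : x ∈ (extChartAt I x).source := mem_extChartAt_source x
  have hX1 : ∀ {x₁}, x ∈ (extChartAt I x₁).source →
      DifferentiableAt ℝ (vectorInChart X x₁) (extChartAt I x₁ x) := fun {x₁} h =>
    ((hX x₁).contDiffAt ((isOpen_extChartAt_target x₁).mem_nhds
      ((extChartAt I x₁).map_source h))).differentiableAt (by simp)
  have hK1 : ∀ {x₁}, x ∈ (extChartAt I x₁).source →
      DifferentiableAt ℝ (K.inChart x₁) (extChartAt I x₁ x) := fun {x₁} h =>
    ((hK x₁).contDiffAt ((isOpen_extChartAt_target x₁).mem_nhds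
      ((extChartAt I x₁).map_source h))).differentiableAt (by simp)
  set φ : E → E := fun z => extChartAt I x₀ ((extChartAt I x).symm z) with hφdef
  have hφx : φ (extChartAt I x x) = extChartAt I x₀ x := by
    simp only [hφdef, (extChartAt I x).left_inv hxx]
  have hφ : ContDiffAt ℝ ∞ φ (extChartAt I x x) :=
    contDiffAt_writtenInCharts (f := id) hxx hx contMDiffAt_id
  have hdφ : ∀ {z}, z ∈ (extChartAt I x).source → z ∈ (extChartAt I x₀).source → ∀ v,
      fderiv ℝ φ (extChartAt I x z) (chartDeriv (I := I) x z v) = chartDeriv (I := I) x₀ z v := by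
    intro z hz hz' v
    refine (fderiv_writtenInCharts (f := id) hz hz' contMDiffAt_id v).trans ?_
    rw [mfderiv_id]
    rfl
  have hnear : ∀ᶠ w in 𝓝 (extChartAt I x x), ∃ z ∈ (extChartAt I x).source,
      z ∈ (extChartAt I x₀).source ∧ extChartAt I x z = w := by
    have hc : ContinuousAt (extChartAt I x).symm (extChartAt I x x) :=
      continuousAt_extChartAt_symm x
    have h1 := hc.eventually_mem ((isOpen_extChartAt_source (I := I) x₀).mem_nhds
      (by rwa [(extChartAt I x).left_inv hxx]))
    filter_upwards [h1, (isOpen_extChartAt_target (I := I) x).mem_nhds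
      ((extChartAt I x).map_source hxx)] with w hw hw'
    exact ⟨_, (extChartAt I x).map_target hw', hw, (extChartAt I x).right_inv hw'⟩
  -- Compare the chart at `x`, which defines the Lie derivative at `x`, with the chart at `x₀`.
  have hnat := fun v => lieLocal_natural (p := p) (X := vectorInChart X x)
    (X' := vectorInChart X x₀) (K := K.inChart x) (K' := K.inChart x₀) hφ (hX1 hxx)
    (by rw [hφx]; exact hX1 hx) (hK1 hxx) (by rw [hφx]; exact hK1 hx)
    (by
      filter_upwards [hnear] with w hw
      obtain ⟨z, hz, hz', rfl⟩ := hw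
      have e1 : φ (extChartAt I x z) = extChartAt I x₀ z := by
        simp only [hφdef, (extChartAt I x).left_inv hz]
      rw [e1, vectorInChart_extChartAt X hz, vectorInChart_extChartAt X hz', hdφ hz hz'])
    (by
      filter_upwards [hnear] with w hw v
      obtain ⟨z, hz, hz', rfl⟩ := hw
      have e1 : φ (extChartAt I x z) = extChartAt I x₀ z := by
        simp only [hφdef, (extChartAt I x).left_inv hz]
      rw [e1, VForm.inChart_apply, VForm.inChart_apply, (extChartAt I x).left_inv hz,
        (extChartAt I x₀).left_inv hz', hdφ hz hz']
      congr 2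
      funext i
      have := hdφ hz hz' ((chartDeriv (I := I) x z).inverse (v i))
      rw [chartDeriv_inverse hz] at this
      rw [this, inverse_chartDeriv hz'])
    v
  ext v
  rw [VForm.inChart_apply, (extChartAt I x₀).left_inv hx, lieDeriv, ofChart_apply,
    ← hdφ hxx hx, chartDeriv_inverse hxx]
  refine (hnat _).trans ?_
  rw [hφx]
  congr 1
  funext i
  rw [hdφ hxx hx, chartDeriv_inverse hx]

/-- Lie derivatives of smooth forms along smooth vector fields are smooth, so that they can be
iterated. -/
theorem VForm.IsSmooth.lieDeriv {p : ℕ} {X : ∀ x : N, TangentSpace I x} {K : VForm I N p}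
    (hX : IsSmoothVector X) (hK : K.IsSmooth) : (lieDeriv X K).IsSmooth := fun x₀ =>
  (contDiffOn_lieLocal (isOpen_extChartAt_target x₀) (hX x₀) (hK x₀)).congr fun _ hy =>
    inChart_lieDeriv hX hK hy

end Smooth

theorem VForm.inChart_sum {p : ℕ} {ι : Type*} (s : Finset ι) (K : ι → VForm I N p) (x₀ : N) :
    VForm.inChart (∑ i ∈ s, K i) x₀ = fun y => ∑ i ∈ s, (K i).inChart x₀ y := by
  funext y
  ext v
  rw [VForm.inChart_apply, ContinuousAlternatingMap.sum_apply, Finset.sum_apply]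
  rw [ContinuousAlternatingMap.sum_apply, map_sum]
  rfl

theorem VForm.IsSmooth.differentiableAt [I.Boundaryless] {p : ℕ} {K : VForm I N p}
    (hK : K.IsSmooth) (x : N) : DifferentiableAt ℝ (K.inChart x) (extChartAt I x x) :=
  ((hK x).contDiffAt (extChartAt_target_mem_nhds x)).differentiableAt (by simp)

theorem IsSmoothVector.differentiableAt [I.Boundaryless] {X : ∀ x : N, TangentSpace I x}
    (hX : IsSmoothVector X) (x : N) : DifferentiableAt ℝ (vectorInChart X x) (extChartAt I x x) :=
  ((hX x).contDiffAt (extChartAt_target_mem_nhds x)).differentiableAt (by simp)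

theorem lieDeriv_sum [I.Boundaryless] {p : ℕ} {ι : Type*} (s : Finset ι)
    (X : ∀ x : N, TangentSpace I x) {K : ι → VForm I N p} (hK : ∀ i ∈ s, (K i).IsSmooth) :
    lieDeriv X (∑ i ∈ s, K i) = ∑ i ∈ s, lieDeriv X (K i) := by
  funext x
  rw [Finset.sum_apply, lieDeriv, VForm.inChart_sum, lieLocal_sum _ _ _
    (fun i hi => (hK i hi).differentiableAt x), ofChart_sum]
  rfl

theorem fnBracket_zero_right {p q : ℕ} (K : VForm I N p) :
    fnBracket K (0 : VForm I N q) = 0 := by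
  funext x
  have h : VForm.inChart (0 : VForm I N q) x = fun _ => 0 := by
    funext y
    ext v
    exact map_zero (chartDeriv (I := I) x _)
  rw [fnBracket, h, fnLocal_zero_right, ofChart_zero]
  rfl

theorem fnBracket_vector [I.Boundaryless] {p : ℕ} {X : ∀ x : N, TangentSpace I x}
    {K : VForm I N p} (hX : IsSmoothVector X) (hK : K.IsSmooth) :
    fnBracket K (fun x => ContinuousAlternatingMap.constOfIsEmpty ℝ _ (Fin 0) (X x)) =
      -lieDeriv X K := by
  funext x
  refine (congrArg (ofChart x) (fnLocal_constOfIsEmpty (hX.differentiableAt x)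
    (hK.differentiableAt x))).trans ?_
  exact ofChart_neg _ _

/-- `[K, X] = -L_X K` for a vector field `X`. -/
theorem gBracket_vector [I.Boundaryless] {X : ∀ x : N, TangentSpace I x}
    {K : GForm I N} (hX : IsSmoothVector X) (hK : ∀ p, (K p).IsSmooth) :
    gBracket K (Pi.single 0 fun x =>
      ContinuousAlternatingMap.constOfIsEmpty ℝ _ (Fin 0) (X x)) =
      fun p => -lieDeriv X (K p) := by
  funext r x
  rw [gBracket, Finset.sum_eq_single ⟨(r, 0), by simp⟩]
  · rw [Pi.single_eq_same, fnBracket_vector hX (hK r)]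
    rfl
  · rintro ⟨⟨a, b⟩, hab⟩ _ hne
    have hb : b ≠ 0 := by
      rintro rfl
      refine hne (Subtype.ext ?_)
      have := Finset.HasAntidiagonal.mem_antidiagonal.1 hab
      exact Prod.ext (by simpa using this) rfl
    rw [Pi.single_eq_of_ne hb, fnBracket_zero_right]
    exact castDegree_zero _
  · intro h
    exact absurd (Finset.mem_attach _ _) h

end Forms

/-! ### Iterated Lie derivatives and the two formal series -/

section Forms

variable {E H : Type*} [NormedAddCommGroup E] [NormedSpace ℝ E] [TopologicalSpace H]
  {I : ModelWithCorners ℝ E H} {N : Type*} [TopologicalSpace N] [ChartedSpace H N]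

theorem VForm.isSmooth_zero {p : ℕ} : VForm.IsSmooth (0 : VForm I N p) := by
  intro x₀
  refine (contDiffOn_const (c := 0)).congr fun y _ => ?_
  ext v
  exact map_zero (chartDeriv (I := I) x₀ _)

theorem VForm.isSmooth_single {p : ℕ} {K : VForm I N p} (hK : K.IsSmooth) (q : ℕ) :
    VForm.IsSmooth ((Pi.single p K : GForm I N) q) := by
  rcases eq_or_ne q p with rfl | h
  · rwa [Pi.single_eq_same]
  · rw [Pi.single_eq_of_ne h]
    exact VForm.isSmooth_zero

theorem VForm.inChart_smul {p : ℕ} (c : ℝ) (K : VForm I N p) (x₀ : N) :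
    VForm.inChart (c • K) x₀ = fun y => c • K.inChart x₀ y := by
  funext y
  ext v
  exact map_smul (chartDeriv (I := I) x₀ _) c _

theorem VForm.IsSmooth.const_smul {p : ℕ} {K : VForm I N p} (hK : K.IsSmooth) (c : ℝ) :
    VForm.IsSmooth (c • K) := fun x₀ => by
  rw [VForm.inChart_smul]
  exact (hK x₀).const_smul c

theorem lieDeriv_smul [I.Boundaryless] {p : ℕ} (X : ∀ x : N, TangentSpace I x) (c : ℝ)
    {K : VForm I N p} (hK : K.IsSmooth) : lieDeriv X (c • K) = c • lieDeriv X K := by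
  funext x
  have h : lieLocal (vectorInChart X x) (fun y => c • K.inChart x y) (extChartAt I x x) =
      c • lieLocal (vectorInChart X x) (K.inChart x) (extChartAt I x x) := by
    simp only [lieLocal, derivationAction_eq, map_smul, fderiv_fun_const_smul
      (hK.differentiableAt x), smul_add, smul_sub, smul_apply]
    congr 2
    exact map_smul (ContinuousLinearMap.compContinuousAlternatingMapCLM ℝ E E E (Fin p)
      (fderiv ℝ (vectorInChart X x) (extChartAt I x x))) c (K.inChart x (extChartAt I x x))
  have h2 := congrArg (ofChart (I := I) x) h
  rw [← VForm.inChart_smul] at h2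
  refine h2.trans ?_
  ext v
  exact map_smul (chartDeriv (I := I) x x).inverse c _

theorem gBracket_smul_vector [I.Boundaryless] {X : ∀ x : N, TangentSpace I x} {K : GForm I N}
    (hX : IsSmoothVector X) (hK : ∀ p, (K p).IsSmooth) (c : ℝ) :
    gBracket (c • K) (Pi.single 0 fun x =>
      ContinuousAlternatingMap.constOfIsEmpty ℝ _ (Fin 0) (X x)) =
      (-c) • fun p => lieDeriv X (K p) := by
  have hcK : ∀ p, VForm.IsSmooth ((c • K) p) := fun p => (hK p).const_smul c
  rw [gBracket_vector hX hcK]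
  funext p
  rw [Pi.smul_apply, Pi.smul_apply, lieDeriv_smul X c (hK p), neg_smul]

/-- The iterated Lie derivative `L_{X_{k-1}} ⋯ L_{X_0} K`. -/
def iterLie (K : GForm I N) : (k : ℕ) → (Fin k → ∀ x : N, TangentSpace I x) → GForm I N
  | 0, _ => K
  | k + 1, X => fun p => lieDeriv (X (Fin.last k)) (iterLie K k (fun i => X i.castSucc) p)

section Smooth

variable [I.Boundaryless] [IsManifold I ∞ N] {K : GForm I N}

theorem isSmooth_iterLie (hK : ∀ p, (K p).IsSmooth) {k : ℕ}
    {X : Fin k → ∀ x : N, TangentSpace I x}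
    (hX : ∀ i, IsSmoothVector (X i)) (p : ℕ) : (iterLie K k X p).IsSmooth := by
  induction k with
  | zero => exact hK p
  | succ k ih => exact VForm.IsSmooth.lieDeriv (hX _) (ih fun i => hX _)

/-- Multilinear expansion of `L_{ξ(ε)}^k K`: its coefficient of `ε^n` is the sum of the iterated Lie
derivatives along `ξ_{i_1}, …, ξ_{i_k}` over all `i_1 + ⋯ + i_k = n`. -/
theorem lieSeries_iterate (hK : ∀ p, (K p).IsSmooth)
    {ξ : ℕ → ∀ x : N, TangentSpace I x} (hξ : ∀ i, IsSmoothVector (ξ i)) (k n : ℕ) :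
    (lieSeries ξ)^[k] (Pi.single 0 K) n =
      ∑ i ∈ Finset.Nat.antidiagonalTuple k n, iterLie K k fun j => ξ (i j) := by
  induction k generalizing n with
  | zero =>
    cases n with
    | zero => simp [iterLie]
    | succ n => simp
  | succ k ih =>
    have hstep : ∀ a ∈ Finset.HasAntidiagonal.antidiagonal n,
        (fun p => lieDeriv (ξ a.1) ((lieSeries ξ)^[k] (Pi.single 0 K) a.2 p) : GForm I N) =
        ∑ i ∈ Finset.Nat.antidiagonalTuple k a.2,
          iterLie K (k + 1) fun j => ξ ((Fin.snoc i a.1 : Fin (k + 1) → ℕ) j) := by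
      intro a _
      funext p
      rw [ih, Finset.sum_apply, Finset.sum_apply, lieDeriv_sum _ _ fun i _ =>
        isSmooth_iterLie hK (fun j => hξ _) p]
      refine Finset.sum_congr rfl fun i _ => ?_
      simp only [iterLie, Fin.snoc_last, Fin.snoc_castSucc]
    rw [Function.iterate_succ_apply', lieSeries, Finset.sum_congr rfl hstep, Finset.sum_sigma']
    -- The Lie derivative applied last carries the last index, so tuples are split by `Fin.snoc`.
    refine Finset.sum_bij' (fun a _ => (Fin.snoc a.2 a.1.1 : Fin (k + 1) → ℕ))
      (fun i _ => ⟨(i (Fin.last k), ∑ j : Fin k, i j.castSucc), fun j => i j.castSucc⟩)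
      ?_ ?_ ?_ ?_ ?_
    · rintro ⟨⟨a, b⟩, i⟩ h
      simp only [Finset.mem_sigma, Finset.HasAntidiagonal.mem_antidiagonal,
        Finset.Nat.mem_antidiagonalTuple] at h ⊢
      rw [Fin.sum_univ_castSucc]
      simp only [Fin.snoc_last, Fin.snoc_castSucc]
      omega
    · intro i h
      simp only [Finset.mem_sigma, Finset.HasAntidiagonal.mem_antidiagonal,
        Finset.Nat.mem_antidiagonalTuple] at h ⊢
      rw [Fin.sum_univ_castSucc] at h
      exact ⟨by omega, trivial⟩
    · rintro ⟨⟨a, b⟩, i⟩ h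
      simp only [Finset.mem_sigma, Finset.HasAntidiagonal.mem_antidiagonal,
        Finset.Nat.mem_antidiagonalTuple] at h
      obtain ⟨-, rfl⟩ := h
      simp
    · intro i h
      exact Fin.snoc_init_self i
    · intro a h
      rfl

end Smooth
end Forms

namespace Submanifold

variable {E E' : Type*} [NormedAddCommGroup E] [NormedSpace ℝ E] [FiniteDimensional ℝ E]
  [NormedAddCommGroup E'] [NormedSpace ℝ E'] [FiniteDimensional ℝ E'] {L M : Type*}
  [TopologicalSpace L] [ChartedSpace E L] [IsManifold 𝓘(ℝ, E) ∞ L]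
  [TopologicalSpace M] [ChartedSpace E' M] [IsManifold 𝓘(ℝ, E') ∞ M]
  {S : Submanifold E E' L M}

theorem iota_ofSection (s : S.Section) : (ofSection s).iota = (Pi.single 0 fun e =>
    ContinuousAlternatingMap.constOfIsEmpty ℝ _ (Fin 0) (S.iotaSection s e) :
      GForm S.modelNL S.NL) := rfl

theorem nestedBracket_ofSection {K : GForm S.modelNL S.NL} (hK : ∀ p, (K p).IsSmooth)
    (hs : ∀ s : S.Section, IsSmoothVector (S.iotaSection s)) {n : ℕ} (s : Fin n → S.Section) :
    nestedBracket K n (fun j => ofSection (s j)) =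
      (-1 : ℝ) ^ n • iterLie K n fun j => S.iotaSection (s j) := by
  induction n with
  | zero => simp [nestedBracket, iterLie]
  | succ n ih =>
    rw [nestedBracket, ih, iota_ofSection, pow_succ, mul_neg_one]
    exact gBracket_smul_vector (hs _) (isSmooth_iterLie hK fun _ => hs _) _

theorem projL_smul (c : ℝ) (K : GForm S.modelNL S.NL) : S.projL (c • K) = c • S.projL K := by
  funext p x
  ext v
  exact map_smul (S.normalProj x) c _

theorem projL_zero : S.projL (0 : GForm S.modelNL S.NL) = 0 := by
  funext p x
  ext v
  exact map_zero (S.normalProj x)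

theorem projL_add (K K' : GForm S.modelNL S.NL) : S.projL (K + K') = S.projL K + S.projL K' := by
  funext p x
  ext v
  exact map_add (S.normalProj x) _ _

theorem projL_sum {ι : Type*} (s : Finset ι) (K : ι → GForm S.modelNL S.NL) :
    S.projL (∑ i ∈ s, K i) = ∑ i ∈ s, S.projL (K i) :=
  map_sum (⟨⟨S.projL, projL_zero⟩, projL_add⟩ : GForm S.modelNL S.NL →+ S.GNForm) K s

/-- On sections of `NL` the multibracket is `P_L` of the iterated Lie derivative, without sign: `⋆ = n²`
and the `n` brackets contribute `(-1)^n`. -/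
theorem multibracket_ofSection {K : GForm S.modelNL S.NL} (hK : ∀ p, (K p).IsSmooth)
    (hs : ∀ s : S.Section, IsSmoothVector (S.iotaSection s)) {n : ℕ} (s : Fin n → S.Section) :
    multibracket K n (fun j => ofSection (s j)) =
      S.projL (iterLie K n fun j => S.iotaSection (s j)) := by
  have hexp : ∑ i : Fin n, (n - 1 - (i : ℕ)) * (ofSection (s i)).deg + n * (n + 1) / 2 = n * n := by
    have h1 : ∑ i : Fin n, (n - 1 - (i : ℕ)) * (ofSection (s i)).deg = n * (n - 1) / 2 := by
      rw [← Finset.sum_range_id, ← Finset.sum_range_reflect,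
        ← Fin.sum_univ_eq_sum_range fun j => n - 1 - j]
      exact Finset.sum_congr rfl fun i _ => Nat.mul_one _
    rw [h1]
    cases n with
    | zero => rfl
    | succ m =>
      obtain ⟨t, ht⟩ := Nat.even_mul_succ_self m
      have h2 : (m + 1) * (m + 1 - 1) = 2 * t := by rw [Nat.add_sub_cancel, mul_comm, ht]; ring
      have h3 : (m + 1) * (m + 1 + 1) = 2 * (t + m + 1) := by linarith
      rw [h2, h3, Nat.mul_div_cancel_left _ two_pos, Nat.mul_div_cancel_left _ two_pos]
      linarith
  rw [multibracket, nestedBracket_ofSection hK hs, projL_smul, smul_smul, hexp, ← pow_add,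
    Even.neg_one_pow, one_smul]
  rw [← Nat.mul_succ]
  exact Nat.even_mul_succ_self n

namespace FormalDeformation

/-- The series `F(s(ε))` and `MC(s(ε))` coincide when `P_L K = 0`: their difference is the summand
`k = 0` of the exponential series. -/
theorem formalF_eq_maurerCartan {K : GForm S.modelNL S.NL} (hK : ∀ p, (K p).IsSmooth)
    (hs : ∀ s : S.Section, IsSmoothVector (S.iotaSection s)) (h0 : S.projL K = 0)
    (s : S.FormalDeformation) : s.formalF K = s.maurerCartan K := by
  funext n
  rw [formalF, maurerCartan, expLie, projL_sum, Finset.range_eq_Ico,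
    Finset.sum_eq_sum_Ico_succ_bot (Nat.succ_pos n)]
  have hterm : ∀ k, S.projL (((k.factorial : ℝ)⁻¹) •
      ((lieSeries fun i => S.iotaSection (s.coeff i))^[k] (Pi.single 0 K)) n) =
      ((k.factorial : ℝ)⁻¹) • s.bracketCoeff K k n := by
    intro k
    rw [projL_smul, lieSeries_iterate hK (fun i => hs _), projL_sum, bracketCoeff]
    exact congrArg _ (Finset.sum_congr rfl fun i _ =>
      (multibracket_ofSection hK hs fun j => s.coeff (i j)).symm)
  have hzero : S.projL (((Nat.factorial 0 : ℝ)⁻¹) •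
      ((lieSeries fun i => S.iotaSection (s.coeff i))^[0] (Pi.single 0 K)) n) = 0 := by
    rw [projL_smul, Function.iterate_zero_apply]
    rcases eq_or_ne n 0 with rfl | hn
    · rw [Pi.single_eq_same, h0, smul_zero]
    · rw [Pi.single_eq_of_ne hn, projL_zero, smul_zero]
  rw [hzero, zero_add]
  exact Finset.sum_congr (by ext k; simp [Nat.succ_le_iff]) fun k _ => hterm k

end FormalDeformation
end Submanifold

/-! ### Smoothness of vertical lifts and of pullbacks by tubular neighbourhoods -/

namespace Submanifold

variable {E E' : Type*} [NormedAddCommGroup E] [NormedSpace ℝ E] [FiniteDimensional ℝ E]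
  [NormedAddCommGroup E'] [NormedSpace ℝ E'] [FiniteDimensional ℝ E'] {L M : Type*}
  [TopologicalSpace L] [ChartedSpace E L] [IsManifold 𝓘(ℝ, E) ∞ L]
  [TopologicalSpace M] [ChartedSpace E' M] [IsManifold 𝓘(ℝ, E') ∞ M]
  {S : Submanifold E E' L M}

theorem mem_extChartAt_NL_source {e₀ e : S.NL} :
    e ∈ (extChartAt S.modelNL e₀).source ↔
      e.proj ∈ (extChartAt 𝓘(ℝ, E) e₀.proj).source ∧
        e.proj ∈ (trivializationAt S.ModelFibre S.Normal e₀.proj).baseSet := by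
  have h : e ∈ (trivializationAt S.ModelFibre S.Normal e₀.proj).source ↔
      e.proj ∈ (trivializationAt S.ModelFibre S.Normal e₀.proj).baseSet :=
    Trivialization.mem_source _
  have h1 : e ∈ (extChartAt S.modelNL e₀).source ↔
      e ∈ (trivializationAt S.ModelFibre S.Normal e₀.proj).source ∧
      ((trivializationAt S.ModelFibre S.Normal e₀.proj) e).1 ∈
        (extChartAt 𝓘(ℝ, E) e₀.proj).source ∧ True := by
    rw [FiberBundle.extChartAt]
    rfl
  rw [h1, and_true, and_comm]
  refine ⟨fun ⟨ha, hb⟩ => ⟨?_, h.1 hb⟩, fun ⟨ha, hb⟩ => ⟨?_, h.2 hb⟩⟩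
  · rwa [Trivialization.coe_fst _ hb] at ha
  · rwa [Trivialization.coe_fst' _ hb]

theorem extChartAt_NL_apply (e₀ e : S.NL)
    (he : e.proj ∈ (trivializationAt S.ModelFibre S.Normal e₀.proj).baseSet) :
    extChartAt S.modelNL e₀ e = (extChartAt 𝓘(ℝ, E) e₀.proj e.proj,
      (trivializationAt S.ModelFibre S.Normal e₀.proj).continuousLinearMapAt ℝ e.proj e.2) := by
  rw [FiberBundle.extChartAt, Trivialization.continuousLinearMapAt_apply_of_mem (R := ℝ) _ he]
  have h : ((trivializationAt S.ModelFibre S.Normal e₀.proj) e).1 = e.proj :=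
    Trivialization.coe_fst' _ he
  change (extChartAt 𝓘(ℝ, E) e₀.proj ((trivializationAt S.ModelFibre S.Normal e₀.proj) e).1, _) = _
  rw [h]
  rfl

/-- In the charts of `NL` the vertical lift of `n` has no component along `L`, and its fibre component
is the coordinate of `n` in the trivialization. -/
theorem chartDeriv_verticalLift {e₀ e : S.NL} (he : e ∈ (extChartAt S.modelNL e₀).source)
    (n : S.Normal e.proj) :
    chartDeriv (I := S.modelNL) e₀ e (S.verticalLift e n) =
      (0, (trivializationAt S.ModelFibre S.Normal e₀.proj).continuousLinearMapAt ℝ e.proj n) := by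
  set t := trivializationAt S.ModelFibre S.Normal e.proj with ht
  set t₀ := trivializationAt S.ModelFibre S.Normal e₀.proj with ht₀
  have hmem : e.proj ∈ t.baseSet := mem_baseSet_trivializationAt _ _ _
  have hmem₀ : e.proj ∈ t₀.baseSet := (mem_extChartAt_NL_source.1 he).2
  set c : S.ModelFibre → S.NL := fun f => ⟨e.proj, e.2 + t.symmL ℝ e.proj f⟩ with hc
  have hc0 : c 0 = e := by simp [hc]
  have hcs : ContMDiffAt 𝓘(ℝ, S.ModelFibre) S.modelNL ∞ c 0 := by
    rw [Bundle.contMDiffAt_totalSpace]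
    refine ⟨contMDiffAt_const, ?_⟩
    have : ContMDiffAt 𝓘(ℝ, S.ModelFibre) 𝓘(ℝ, S.ModelFibre) ∞
        (fun f : S.ModelFibre => t.continuousLinearMapAt ℝ e.proj e.2 + f) 0 :=
      contMDiffAt_const.add contMDiffAt_id
    refine this.congr_of_eventuallyEq (Filter.Eventually.of_forall fun f => ?_)
    have h2 := t.continuousLinearMapAt_apply_of_mem (R := ℝ) hmem (e.2 + t.symmL ℝ e.proj f)
    rw [map_add, t.continuousLinearMapAt_symmL hmem] at h2
    exact h2.symm
  have hchart : HasMFDerivAt S.modelNL 𝓘(ℝ, E × S.ModelFibre) (extChartAt S.modelNL e₀) e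
      (chartDeriv (I := S.modelNL) e₀ e) :=
    ((contMDiffAt_extChartAt' (n := ∞)
      (by rwa [← extChartAt_source S.modelNL])).mdifferentiableAt (by simp)).hasMFDerivAt
  have hchart' : HasMFDerivAt S.modelNL 𝓘(ℝ, E × S.ModelFibre) (extChartAt S.modelNL e₀) (c 0)
      (chartDeriv (I := S.modelNL) e₀ e) := by
    rw [hc0]; exact hchart
  have h1 := hchart'.comp 0 (hcs.mdifferentiableAt (by simp)).hasMFDerivAt
  have h2 : HasFDerivAt (fun f : S.ModelFibre => (extChartAt 𝓘(ℝ, E) e₀.proj e.proj,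
      t₀.continuousLinearMapAt ℝ e.proj e.2 +
        (t₀.continuousLinearMapAt ℝ e.proj).comp (t.symmL ℝ e.proj) f))
      ((0 : S.ModelFibre →L[ℝ] E).prod ((t₀.continuousLinearMapAt ℝ e.proj).comp (t.symmL ℝ e.proj)))
      0 :=
    (hasFDerivAt_const _ _).prodMk ((ContinuousLinearMap.hasFDerivAt _).const_add _)
  -- In the chart around `e₀` the curve `c` in the fibre is affine.
  have h3 : extChartAt S.modelNL e₀ ∘ c = fun f : S.ModelFibre => (extChartAt 𝓘(ℝ, E) e₀.proj e.proj,
      t₀.continuousLinearMapAt ℝ e.proj e.2 +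
        (t₀.continuousLinearMapAt ℝ e.proj).comp (t.symmL ℝ e.proj) f) := by
    funext f
    refine (extChartAt_NL_apply e₀ (c f) hmem₀).trans ?_
    exact congrArg (Prod.mk _) ((t₀.continuousLinearMapAt ℝ e.proj).map_add _ _)
  rw [h3] at h1
  let A : S.ModelFibre →L[ℝ] E × S.ModelFibre :=
    (chartDeriv (I := S.modelNL) e₀ e).comp (mfderiv 𝓘(ℝ, S.ModelFibre) S.modelNL c 0 :
      S.ModelFibre →L[ℝ] TangentSpace S.modelNL e)
  have h1' : HasFDerivAt (fun f : S.ModelFibre => (extChartAt 𝓘(ℝ, E) e₀.proj e.proj,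
      t₀.continuousLinearMapAt ℝ e.proj e.2 +
        (t₀.continuousLinearMapAt ℝ e.proj).comp (t.symmL ℝ e.proj) f)) A 0 := h1.hasFDerivAt
  have h4 := DFunLike.congr_fun (h1'.unique h2) (t.continuousLinearMapAt ℝ e.proj n)
  refine Eq.trans h4 ?_
  refine Prod.ext rfl ?_
  exact congrArg (t₀.continuousLinearMapAt ℝ e.proj) (t.symmL_continuousLinearMapAt hmem n)

theorem isSmoothVector_iotaSection (s : S.Section) :
    IsSmoothVector (S.iotaSection s) := by
  intro e₀ y hy
  obtain ⟨e, he, rfl⟩ : ∃ e ∈ (extChartAt S.modelNL e₀).source, extChartAt S.modelNL e₀ e = y :=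
    ⟨_, (extChartAt S.modelNL e₀).map_target hy, (extChartAt S.modelNL e₀).right_inv hy⟩
  have hopen := (isOpen_extChartAt_target (I := S.modelNL) e₀).mem_nhds hy
  have hl := (extChartAt S.modelNL e₀).left_inv he
  have h1 : ContMDiffAt 𝓘(ℝ, E × S.ModelFibre) S.modelNL ∞ (extChartAt S.modelNL e₀).symm
      (extChartAt S.modelNL e₀ e) := (contMDiffOn_extChartAt_symm e₀).contMDiffAt hopen
  have h2 : ContMDiffAt S.modelNL 𝓘(ℝ, E) ∞ (TotalSpace.proj : S.NL → L)
      ((extChartAt S.modelNL e₀).symm (extChartAt S.modelNL e₀ e)) := Bundle.contMDiff_proj _ _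
  have h3 : ContMDiffAt 𝓘(ℝ, E) 𝓘(ℝ, S.ModelFibre) ∞
      (fun x => (trivializationAt S.ModelFibre S.Normal e₀.proj ⟨x, s x⟩).2)
      ((extChartAt S.modelNL e₀).symm (extChartAt S.modelNL e₀ e)).proj :=
    (Trivialization.contMDiffAt_section_iff (e := trivializationAt S.ModelFibre S.Normal e₀.proj)
      (by rw [hl]; exact (mem_extChartAt_NL_source.1 he).2)).1 (s.contMDiff _)
  have h4 : ContDiffAt ℝ ∞ (fun z : E × S.ModelFibre =>
      (trivializationAt S.ModelFibre S.Normal e₀.proj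
        ⟨((extChartAt S.modelNL e₀).symm z).proj, s ((extChartAt S.modelNL e₀).symm z).proj⟩).2)
      (extChartAt S.modelNL e₀ e) := by
    rw [← contMDiffAt_iff_contDiffAt]
    exact (h3.comp _ h2).comp _ h1
  refine ((contDiffAt_const (c := (0 : E))).prodMk h4).contDiffWithinAt.congr_of_eventuallyEq ?_ ?_
  · filter_upwards [self_mem_nhdsWithin] with z hz
    refine (chartDeriv_verticalLift ((extChartAt S.modelNL e₀).map_target hz) _).trans ?_
    rw [Trivialization.continuousLinearMapAt_apply_of_mem (R := ℝ) _
      (mem_extChartAt_NL_source.1 ((extChartAt S.modelNL e₀).map_target hz)).2]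
  · refine (chartDeriv_verticalLift ((extChartAt S.modelNL e₀).map_target hy) _).trans ?_
    rw [Trivialization.continuousLinearMapAt_apply_of_mem (R := ℝ) _
      (mem_extChartAt_NL_source.1 ((extChartAt S.modelNL e₀).map_target hy)).2]

namespace TubularNeighborhood

variable (τ : S.TubularNeighborhood) {p : ℕ} {Ψ : VForm 𝓘(ℝ, E') M p}

theorem mfderiv_isInvertible (e : S.NL) :
    (mfderiv S.modelNL 𝓘(ℝ, E') τ.toFun e).IsInvertible :=
  ⟨_, τ.isLocalDiffeomorph.mfderivToContinuousLinearEquiv_coe (by simp) e⟩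

theorem isSmooth_pullback (hΨ : Ψ.IsSmooth) : (τ.pullback Ψ).IsSmooth := by
  intro e₀ y hy
  obtain ⟨e, he, rfl⟩ : ∃ e ∈ (extChartAt S.modelNL e₀).source, extChartAt S.modelNL e₀ e = y :=
    ⟨_, (extChartAt S.modelNL e₀).map_target hy, (extChartAt S.modelNL e₀).right_inv hy⟩
  apply ContDiffAt.contDiffWithinAt
  have hτ : ∀ e, ContMDiffAt S.modelNL 𝓘(ℝ, E') ∞ τ.toFun e := τ.isLocalDiffeomorph.contMDiff
  set x₁ := τ.toFun e with hx₁
  set φ : E × S.ModelFibre → E' :=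
    fun z => extChartAt 𝓘(ℝ, E') x₁ (τ.toFun ((extChartAt S.modelNL e₀).symm z)) with hφdef
  have hφe : ∀ {e'}, e' ∈ (extChartAt S.modelNL e₀).source →
      φ (extChartAt S.modelNL e₀ e') = extChartAt 𝓘(ℝ, E') x₁ (τ.toFun e') := fun {e'} h => by
    simp only [hφdef, (extChartAt S.modelNL e₀).left_inv h]
  have hφ : ContDiffAt ℝ ∞ φ (extChartAt S.modelNL e₀ e) :=
    contDiffAt_writtenInCharts he (mem_extChartAt_source _) (hτ e)
  have hD : ∀ {e'}, e' ∈ (extChartAt S.modelNL e₀).source →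
      τ.toFun e' ∈ (extChartAt 𝓘(ℝ, E') x₁).source → ∀ v,
      fderiv ℝ φ (extChartAt S.modelNL e₀ e') (chartDeriv (I := S.modelNL) e₀ e' v) =
      chartDeriv (I := 𝓘(ℝ, E')) x₁ (τ.toFun e') (mfderiv S.modelNL 𝓘(ℝ, E') τ.toFun e' v) :=
    fun h h' v => fderiv_writtenInCharts h h' (hτ _) v
  have hinv : ∀ {e'}, e' ∈ (extChartAt S.modelNL e₀).source →
      τ.toFun e' ∈ (extChartAt 𝓘(ℝ, E') x₁).source →
      (fderiv ℝ φ (extChartAt S.modelNL e₀ e')).IsInvertible := by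
    intro e' h h'
    obtain ⟨a, ha⟩ := chartDeriv_isInvertible (I := S.modelNL) h
    obtain ⟨b, hb⟩ := chartDeriv_isInvertible (I := 𝓘(ℝ, E')) h'
    obtain ⟨T, hT⟩ := τ.mfderiv_isInvertible e'
    refine ⟨a.symm.trans (T.trans b), ContinuousLinearMap.ext fun v => ?_⟩
    have := hD h h' (a.symm v)
    rw [← ha, ← hb, ← hT] at this
    simp only [ContinuousLinearEquiv.coe_coe, ContinuousLinearEquiv.apply_symm_apply] at this
    exact this.symm
  have hfd : ContDiffAt ℝ ∞ (fderiv ℝ φ) (extChartAt S.modelNL e₀ e) :=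
    hφ.fderiv_right (by simp)
  have hfi : ContDiffAt ℝ ∞ (fun z => (fderiv ℝ φ z).inverse) (extChartAt S.modelNL e₀ e) := by
    obtain ⟨A, hA⟩ := hinv he (mem_extChartAt_source _)
    have := contDiffAt_map_inverse (n := ∞) A
    rw [hA] at this
    exact this.comp _ hfd
  have hΨ1 : ContDiffAt ℝ ∞ (fun z => Ψ.inChart x₁ (φ z)) (extChartAt S.modelNL e₀ e) := by
    have := (hΨ x₁).contDiffAt (extChartAt_target_mem_nhds (I := 𝓘(ℝ, E')) x₁)
    rw [hx₁, ← hφe he] at this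
    exact this.comp _ hφ
  refine (contDiffAt_formPullback hΨ1 hfd hfi).congr_of_eventuallyEq ?_
  have hc : ContinuousAt (fun z => τ.toFun ((extChartAt S.modelNL e₀).symm z))
      (extChartAt S.modelNL e₀ e) := by
    refine ContinuousAt.comp (hτ _).continuousAt (continuousAt_extChartAt_symm' he)
  have h1 := hc.eventually_mem ((isOpen_extChartAt_source (I := 𝓘(ℝ, E')) x₁).mem_nhds
    (by rw [(extChartAt S.modelNL e₀).left_inv he]; exact mem_extChartAt_source _))
  filter_upwards [h1, (isOpen_extChartAt_target (I := S.modelNL) e₀).mem_nhds hy] with z hz hz'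
  obtain ⟨e', he', rfl⟩ : ∃ e ∈ (extChartAt S.modelNL e₀).source, extChartAt S.modelNL e₀ e = z :=
    ⟨_, (extChartAt S.modelNL e₀).map_target hz', (extChartAt S.modelNL e₀).right_inv hz'⟩
  rw [(extChartAt S.modelNL e₀).left_inv he'] at hz
  have hdi := hinv he' hz
  have hmi := τ.mfderiv_isInvertible e'
  -- With `D`, `T` the differentials of `φ`, `τ` and `c₀`, `c₁` those of the charts, `D c₀ = c₁ T` gives
  -- `c₀ T⁻¹ = D⁻¹ c₁` and `T c₀⁻¹ = c₁⁻¹ D`.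
  have hout : ∀ w, chartDeriv (I := S.modelNL) e₀ e'
      ((mfderiv S.modelNL 𝓘(ℝ, E') τ.toFun e').inverse w) =
      (fderiv ℝ φ (extChartAt S.modelNL e₀ e')).inverse
        (chartDeriv (I := 𝓘(ℝ, E')) x₁ (τ.toFun e') w) := by
    intro w
    have := hD he' hz ((mfderiv S.modelNL 𝓘(ℝ, E') τ.toFun e').inverse w)
    rw [hmi.self_apply_inverse] at this
    rw [← this, hdi.inverse_apply_self]
  have hin : ∀ v, mfderiv S.modelNL 𝓘(ℝ, E') τ.toFun e'
      ((chartDeriv (I := S.modelNL) e₀ e').inverse v) =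
      (chartDeriv (I := 𝓘(ℝ, E')) x₁ (τ.toFun e')).inverse
        (fderiv ℝ φ (extChartAt S.modelNL e₀ e') v) := by
    intro v
    have := hD he' hz ((chartDeriv (I := S.modelNL) e₀ e').inverse v)
    rw [chartDeriv_inverse he'] at this
    rw [this, inverse_chartDeriv hz]
  refine ContinuousAlternatingMap.ext fun v => ?_
  rw [VForm.inChart_apply, (extChartAt S.modelNL e₀).left_inv he']
  refine (hout _).trans ?_
  change _ = (fderiv ℝ φ (extChartAt S.modelNL e₀ e')).inverse
    (Ψ.inChart x₁ (φ (extChartAt S.modelNL e₀ e')) _)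
  rw [hφe he', VForm.inChart_apply, (extChartAt 𝓘(ℝ, E') x₁).left_inv hz]
  exact congrArg (fun u => (fderiv ℝ φ (extChartAt S.modelNL e₀ e')).inverse
    (chartDeriv (I := 𝓘(ℝ, E')) x₁ (τ.toFun e') (Ψ (τ.toFun e') u))) (funext fun i => hin (v i))

theorem isSmooth_delta (hΨ : Ψ.IsSmooth) (q : ℕ) : (τ.delta Ψ q).IsSmooth :=
  VForm.isSmooth_single (τ.isSmooth_pullback hΨ) q

/-- The differential of `τ` maps tangent vectors of the zero section to those of `L ⊂ M`. -/
theorem mfderiv_comp_zeroSection (x : L) (v : TangentSpace 𝓘(ℝ, E) x) :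
    mfderiv S.modelNL 𝓘(ℝ, E') τ.toFun (⟨x, 0⟩ : S.NL)
      (mfderiv 𝓘(ℝ, E) S.modelNL (fun z : L => (⟨z, 0⟩ : S.NL)) x v) = S.dIncl x v := by
  have hz : MDifferentiableAt 𝓘(ℝ, E) S.modelNL (fun z : L => (⟨z, 0⟩ : S.NL)) x :=
    (contMDiff_zeroSection ℝ S.Normal (n := ∞) (IB := 𝓘(ℝ, E)) x).mdifferentiableAt (by simp)
  have hτ : MDifferentiableAt S.modelNL 𝓘(ℝ, E') τ.toFun (⟨x, 0⟩ : S.NL) :=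
    τ.isLocalDiffeomorph.mdifferentiable (by simp) _
  have h := mfderiv_comp x hτ hz
  have h2 : τ.toFun ∘ (fun z : L => (⟨z, 0⟩ : S.NL)) = S.incl := funext τ.zeroSection
  have h3 : ∀ (f : L → M), f = S.incl → ∀ v, (mfderiv 𝓘(ℝ, E) 𝓘(ℝ, E') f x v : E') =
      S.dIncl x v := by
    rintro _ rfl v
    rfl
  exact (congrArg (fun T => T v) h).symm.trans (h3 _ h2 v)

end TubularNeighborhood

/-- Tangent vectors of the zero section have vanishing normal component. -/
theorem normalProj_zeroSection (x : L) (v : TangentSpace 𝓘(ℝ, E) x) :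
    S.normalProj x (mfderiv 𝓘(ℝ, E) S.modelNL (fun z : L => (⟨z, 0⟩ : S.NL)) x v) = 0 := by
  have hz : MDifferentiableAt 𝓘(ℝ, E) S.modelNL (fun z : L => (⟨z, 0⟩ : S.NL)) x :=
    (contMDiff_zeroSection ℝ S.Normal (n := ∞) (IB := 𝓘(ℝ, E)) x).mdifferentiableAt (by simp)
  have ht : MDifferentiableAt S.modelNL 𝓘(ℝ, S.ModelFibre)
      (fun e : S.NL => (trivializationAt S.ModelFibre S.Normal x e).2) (⟨x, 0⟩ : S.NL) :=
    ((Bundle.contMDiffAt_totalSpace.1 (contMDiffAt_id (I := S.modelNL) (n := ∞)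
      (x := (⟨x, 0⟩ : S.NL)))).2).mdifferentiableAt (by simp)
  have h := mfderiv_comp x ht hz
  have heq : (fun e : S.NL => (trivializationAt S.ModelFibre S.Normal x e).2) ∘
      (fun z : L => (⟨z, 0⟩ : S.NL)) =ᶠ[𝓝 x] fun _ => 0 := by
    filter_upwards [(trivializationAt S.ModelFibre S.Normal x).open_baseSet.mem_nhds
      (mem_baseSet_trivializationAt _ _ _)] with z hz
    have := (trivializationAt S.ModelFibre S.Normal x).continuousLinearMapAt_apply_of_mem
      (R := ℝ) hz 0
    rw [map_zero] at this
    exact this.symm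
  rw [heq.mfderiv_eq, mfderiv_const] at h
  have h2 := congrArg (fun T => T v) h
  refine (congrArg ((trivializationAt S.ModelFibre S.Normal x).symmL ℝ x) h2.symm).trans ?_
  exact map_zero _

/-- A `Ψ`-submanifold satisfies `P_L (τ^* Ψ) = 0`. -/
theorem projL_delta (τ : S.TubularNeighborhood) {p : ℕ} {Ψ : VForm 𝓘(ℝ, E') M p}
    (hL : S.IsPsiSubmanifold Ψ) : S.projL (τ.delta Ψ) = 0 := by
  funext q x
  rcases eq_or_ne q p with rfl | hq
  · ext v
    have hv := congrArg (fun K => K v) (hL.2 x)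
    obtain ⟨w, hw⟩ := S.pr_eq_zero.1 hv
    have hinv : (mfderiv S.modelNL 𝓘(ℝ, E') τ.toFun (⟨x, 0⟩ : S.NL)).inverse (S.dIncl x w) =
        mfderiv 𝓘(ℝ, E) S.modelNL (fun z : L => (⟨z, 0⟩ : S.NL)) x w := by
      refine (congrArg _ (τ.mfderiv_comp_zeroSection x w).symm).trans ?_
      exact (τ.mfderiv_isInvertible _).inverse_apply_self _
    have hval : τ.pullback Ψ (⟨x, 0⟩ : S.NL)
        (fun i => mfderiv 𝓘(ℝ, E) S.modelNL (fun z : L => (⟨z, 0⟩ : S.NL)) x (v i)) =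
        (mfderiv S.modelNL 𝓘(ℝ, E') τ.toFun (⟨x, 0⟩ : S.NL)).inverse
          (Ψ (τ.toFun ⟨x, 0⟩) fun i => S.dIncl x (v i)) :=
      congrArg (fun u => (mfderiv S.modelNL 𝓘(ℝ, E') τ.toFun (⟨x, 0⟩ : S.NL)).inverse
        (Ψ (τ.toFun ⟨x, 0⟩) u)) (funext fun i => τ.mfderiv_comp_zeroSection x (v i))
    -- The points `τ(0_x)` and `j(x)` are only propositionally equal; on the model space `E'`, to
    -- which all tangent spaces unfold, the values of `Ψ` at the two points can be compared.
    have hΨx : ∀ (y : M), y = S.incl x → ∀ u : Fin q → E', (Ψ y u : E') = Ψ (S.incl x) u := by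
      rintro _ rfl u
      rfl
    have hval' := hval.trans (congrArg
      (mfderiv S.modelNL 𝓘(ℝ, E') τ.toFun (⟨x, 0⟩ : S.NL)).inverse
      ((hΨx _ (τ.zeroSection x) fun i => S.dIncl x (v i)).trans hw.symm))
    have hδ : τ.delta Ψ q = τ.pullback Ψ := Pi.single_eq_same _ _
    change S.normalProj x (τ.delta Ψ q _ _) = 0
    rw [hδ]
    exact (congrArg (S.normalProj x) (hval'.trans hinv)).trans (normalProj_zeroSection x w)
  · have : τ.delta Ψ q = 0 := Pi.single_eq_of_ne hq _
    ext v
    change S.normalProj x (τ.delta Ψ q _ _) = 0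
    rw [this]
    exact map_zero _

end Submanifold

end PsiDeformation

end

open PsiDeformation
theorem proposition5p10
    {E E' : Type*} [NormedAddCommGroup E] [NormedSpace ℝ E] [FiniteDimensional ℝ E]
    [NormedAddCommGroup E'] [NormedSpace ℝ E'] [FiniteDimensional ℝ E']
    {L M : Type*} [TopologicalSpace L] [ChartedSpace E L] [IsManifold 𝓘(ℝ, E) ∞ L]
    [TopologicalSpace M] [ChartedSpace E' M] [IsManifold 𝓘(ℝ, E') ∞ M]
    (S : Submanifold E E' L M) (τ : S.TubularNeighborhood)
    (k : ℕ) (Ψ : VForm 𝓘(ℝ, E') M (2 * k + 1)) (hΨ : Ψ.IsSmooth) (hsq : fnBracket Ψ Ψ = 0)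
    (hL : S.IsPsiSubmanifold Ψ) (s : S.FormalDeformation) :
    (s.IsFormalPsiDeformation τ Ψ ↔ s.IsMaurerCartan τ Ψ) ∧
      ((-s).IsFormalPsiDeformation τ Ψ ↔ (-s).IsMaurerCartan τ Ψ) := by
  have h : ∀ s : S.FormalDeformation, s.IsFormalPsiDeformation τ Ψ ↔ s.IsMaurerCartan τ Ψ :=
    fun s => by
      rw [Submanifold.FormalDeformation.IsFormalPsiDeformation,
        Submanifold.FormalDeformation.IsMaurerCartan,
        Submanifold.FormalDeformation.formalF_eq_maurerCartan (τ.isSmooth_delta hΨ)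
          Submanifold.isSmoothVector_iotaSection (Submanifold.projL_delta τ hL)]
  exact ⟨h s, h (-s)⟩
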